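/- Let $N\ge 1$ be an odd integer. For $r\ge 2$ let $\Gamma_r=\ker\big(\mathbb{Z}_2^\times\to(\mathbb{Z}_2/2^r\mathbb{Z}_2)^\times\big)=1+2^r\mathbb{Z}_2$, put $\Gamma=\Gamma_2$, let $\Lambda=\mathbb{Z}_2[[\Gamma]]=\varprojlim_{r\ge 2}\mathbb{Z}_2[\Gamma/\Gamma_r]$, and let $\mathfrak{a}_r=\ker\big(\Lambda\to\mathbb{Z}_2[\Gamma/\Gamma_r]\big)$ be the augmentation ideal of $\Gamma_r$ in $\Lambda$. *The $\Lambda$-modules.* Let $\Phi_r=\Gamma_1(4N)\cap\Gamma_0(2^r)$. The map $\left(\begin{smallmatrix}a&b\\c&d\end{smallmatrix}\right)\mapsto d \bmod \Gamma_r$ is a surjective homomorphism $\Phi_r\to\Gamma/\Gamma_r$ with kernel $\Gamma_1(N2^r)$, so conjugation by $\Phi_r$ gives an action of $\Gamma/\Gamma_r$ on the abelianization $\Gamma_1(N2^r)^{\mathrm{ab}}$. Hence $\Lambda$ acts on $\Gamma_1(N2^r)^{\mathrm{ab}}\otimes\mathbb{Z}_2$ through $\mathbb{Z}_2[\Gamma/\Gamma_r]$.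 The inclusions $\Gamma_1(N2^r)\subset\Gamma_1(N2^s)$, $r\ge s\ge 2$, induce $\Lambda$-linear transition maps. *The operator $U$.* Let $t=\left(\begin{smallmatrix}1&0\\0&2\end{smallmatrix}\right)$ and $G=\Gamma_1(N2^r)$. The operator $U$ on $G^{\mathrm{ab}}$ is the composite $$G^{\mathrm{ab}}\longrightarrow (t^{-1}Gt\cap G)^{\mathrm{ab}}\longrightarrow (G\cap tGt^{-1})^{\mathrm{ab}}\longrightarrow G^{\mathrm{ab}}$$ of the transfer, conjugation $x\mapsto txt^{-1}$, and the map induced by the inclusion; it is extended $\mathbb{Z}_2$-linearly to $G^{\mathrm{ab}}\otimes\mathbb{Z}_2$. *Ordinary parts.* For a finitely generated $\mathbb{Z}_2$-module $M$ with an endomorphism $U$, let $A$ be the image of $\mathbb{Z}_2[X]$ in $\mathrm{End}_{\mathbb{Z}_2}(M)$, where $X$ acts as $U$. The ring $A$ is the product of its localizations at its finitely many maximal ideals; let $A^{\mathrm{ord}}$ be the product of those factors in which $U$ is a unit, and let $M^{\mathrm{ord}}=M\otimes_A A^{\mathrm{ord}}$, regarded as a direct summand of $M$. Put $$\mathbf{W}^{\mathrm{ord}}=\varprojlim_{r\ge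 2}\,(\Gamma_1(N2^r)^{\mathrm{ab}}\otimes\mathbb{Z}_2)^{\mathrm{ord}}.$$ **Theorem.** For every $r\ge 2$, the projection $\mathbf{W}^{\mathrm{ord}}\to(\Gamma_1(N2^r)^{\mathrm{ab}}\otimes\mathbb{Z}_2)^{\mathrm{ord}}$ induces an isomorphism of $\Lambda$-modules $$\mathbf{W}^{\mathrm{ord}}/\mathfrak{a}_r\mathbf{W}^{\mathrm{ord}}\;\cong\;(\Gamma_1(N2^r)^{\mathrm{ab}}\otimes\mathbb{Z}_2)^{\mathrm{ord}},$$ and this module is the module of $\Gamma_r$-coinvariants of $\mathbf{W}^{\mathrm{ord}}$: the same projection induces an isomorphism from the quotient of $\mathbf{W}^{\mathrm{ord}}$ by the $\mathbb{Z}_2$-submodule generated by all $\gamma w-w$ ($\gamma\in\Gamma_r$, $w\in\mathbf{W}^{\mathrm{ord}}$) onto $(\Gamma_1(N2^r)^{\mathrm{ab}}\otimes\mathbb{Z}_2)^{\mathrm{ord}}$. -/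

import Mathlib

open scoped MatrixGroups TensorProduct

noncomputable section

namespace TwoAdicControl

/-! ### Ordinary parts -/

section OrdinaryPart

variable {R M : Type*} [CommRing R] [AddCommGroup M] [Module R M]

/-- The image `A` of `R[X]` in `End_R(M)`, where `X` acts through `U`. -/
def opAlgebra (U : Module.End R M) : Subalgebra R (Module.End R M) :=
  (Polynomial.aeval U : Polynomial R →ₐ[R] Module.End R M).range

instance (U : Module.End R M) : CommRing (opAlgebra U) :=
  { (inferInstance : Ring (opAlgebra U)) with
    mul_comm := by
      rintro ⟨_, P, rfl⟩ ⟨_, Q, rfl⟩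
      apply Subtype.ext
      change Polynomial.aeval U P * Polynomial.aeval U Q
        = Polynomial.aeval U Q * Polynomial.aeval U P
      rw [← map_mul, mul_comm, map_mul] }

/-- `U` as an element of `A`. -/
def opElem (U : Module.End R M) : opAlgebra U :=
  ⟨U, Polynomial.X, by simp⟩

/-- The ordinary part `Mᵒʳᵈ = M ⊗_A Aᵒʳᵈ` of a finitely generated `ℤ_p`-module `M`, as a submodule
of `M`. Here `A` is the product of its finitely many localizations `A_𝔪` at maximal ideals, `Aᵒʳᵈ` is
the product of those `A_𝔪` in which the image of `U` is a unit, and `M` is the direct sum of the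
`M_𝔪`; the ordinary part is the summand consisting of the `m` whose components `m_𝔪` at the other
maximal ideals, those that contain `U`, vanish. See `ordinaryPart_bijective` for the comparison. -/
def ordinaryPart (U : Module.End R M) : Submodule R M where
  carrier := {m | ∀ 𝔪 : MaximalSpectrum (opAlgebra U), opElem U ∈ 𝔪.asIdeal →
    LocalizedModule.mkLinearMap 𝔪.asIdeal.primeCompl M m = 0}
  zero_mem' := fun 𝔪 _ => map_zero _
  add_mem' := fun {a b} ha hb 𝔪 h => by rw [map_add, ha 𝔪 h, hb 𝔪 h, add_zero]
  smul_mem' := fun c m hm 𝔪 h => by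
    have := (LocalizedModule.mkLinearMap 𝔪.asIdeal.primeCompl M).map_smul
      (algebraMap R (opAlgebra U) c) m
    rw [algebraMap_smul] at this
    rw [this, hm 𝔪 h, smul_zero]

theorem mem_ordinaryPart_iff (U : Module.End R M) (m : M) :
    m ∈ ordinaryPart U ↔ ∃ Q : Polynomial R, U (Polynomial.aeval U Q m) = m := by
  have key : ∀ 𝔪 : MaximalSpectrum (opAlgebra U),
      LocalizedModule.mkLinearMap 𝔪.asIdeal.primeCompl M m = 0 ↔
        ∃ a : opAlgebra U, a ∉ 𝔪.asIdeal ∧ a • m = 0 := by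
    intro 𝔪
    rw [LocalizedModule.mkLinearMap_apply, ← LocalizedModule.zero_mk 1, LocalizedModule.mk_eq]
    constructor
    · rintro ⟨u, hu⟩
      exact ⟨u.1, u.2, by rwa [smul_zero, one_smul, smul_zero, Submonoid.smul_def] at hu⟩
    · rintro ⟨a, ha, h⟩
      exact ⟨⟨a, ha⟩, by rw [smul_zero, one_smul, smul_zero, Submonoid.smul_def]; exact h⟩
  constructor
  · intro hm
    let J : Ideal (opAlgebra U) := LinearMap.ker (LinearMap.toSpanSingleton (opAlgebra U) M m)
    have hJ : J ⊔ Ideal.span {opElem U} = ⊤ := by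
      by_contra hne
      obtain ⟨𝔪, h𝔪, hle⟩ := Ideal.exists_le_maximal _ hne
      obtain ⟨a, ha, h0⟩ := (key ⟨𝔪, h𝔪⟩).1 (hm ⟨𝔪, h𝔪⟩
        (hle (Ideal.mem_sup_right (Ideal.mem_span_singleton_self _))))
      exact ha (hle (Ideal.mem_sup_left (by
          rw [LinearMap.mem_ker, LinearMap.toSpanSingleton_apply]; exact h0)))
    obtain ⟨j, hj, b, hb, hjb⟩ := Submodule.mem_sup.1 ((Ideal.eq_top_iff_one _).1 hJ)
    obtain ⟨⟨_, Q, rfl⟩, rfl⟩ := Ideal.mem_span_singleton'.1 hb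
    refine ⟨Q, ?_⟩
    have hj' : j • m = 0 := by
      rwa [LinearMap.mem_ker, LinearMap.toSpanSingleton_apply] at hj
    have h1 : (j + _) • m = (1 : opAlgebra U) • m := congrArg (· • m) hjb
    rw [add_smul, hj', zero_add, one_smul, mul_comm] at h1
    exact h1
  · rintro ⟨Q, hQ⟩ 𝔪 h𝔪
    refine (key 𝔪).2 ⟨1 - opElem U * ⟨_, Q, rfl⟩, fun h => ?_, ?_⟩
    · exact 𝔪.isMaximal.ne_top ((Ideal.eq_top_iff_one _).2
        (by simpa using 𝔪.asIdeal.add_mem h (𝔪.asIdeal.mul_mem_right ⟨_, Q, rfl⟩ h𝔪)))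
    · rw [sub_smul, one_smul, sub_eq_zero]
      exact hQ.symm

theorem map_mem_ordinaryPart {M' : Type*} [AddCommGroup M'] [Module R M']
    {U : Module.End R M} {U' : Module.End R M'} (f : M →ₗ[R] M')
    (hf : ∀ x, f (U x) = U' (f x)) {m : M} (hm : m ∈ ordinaryPart U) :
    f m ∈ ordinaryPart U' := by
  obtain ⟨Q, hQ⟩ := (mem_ordinaryPart_iff U m).1 hm
  have hP : ∀ (P : Polynomial R) x, f (Polynomial.aeval U P x) = Polynomial.aeval U' P (f x) := by
    intro P
    induction P using Polynomial.induction_on' with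
    | add p q hp hq => intro x; simp [hp, hq]
    | monomial n a =>
      intro x
      have hn : ∀ k : ℕ, f ((U ^ k) x) = (U' ^ k) (f x) := by
        intro k
        induction k with
        | zero => simp
        | succ k ih => rw [pow_succ', pow_succ', Module.End.mul_apply, hf, ih, Module.End.mul_apply]
      simp [Polynomial.aeval_monomial, hn]
  exact (mem_ordinaryPart_iff U' _).2 ⟨Q, by rw [← hP, ← hf, hQ]⟩

end OrdinaryPart

section Comparison

theorem isAdicComplete_of_finite (M : Type*) [AddCommGroup M] [Module ℤ_[2] M]
    [Module.Finite ℤ_[2] M] : IsAdicComplete (IsLocalRing.maximalIdeal ℤ_[2]) M := by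
  have hpre : IsPrecomplete (IsLocalRing.maximalIdeal ℤ_[2]) M := by
    rw [← AdicCompletion.of_surjective_iff]
    intro z
    obtain ⟨w, rfl⟩ := AdicCompletion.ofTensorProduct_surjective_of_finite
      (IsLocalRing.maximalIdeal ℤ_[2]) M z
    induction w using TensorProduct.induction_on with
    | zero => exact ⟨0, by rw [map_zero, map_zero]⟩
    | tmul a x =>
      obtain ⟨c, rfl⟩ := AdicCompletion.of_surjective (IsLocalRing.maximalIdeal ℤ_[2]) ℤ_[2] a
      refine ⟨c • x, ?_⟩
      rw [AdicCompletion.ofTensorProduct_tmul]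
      ext n
      rfl
    | add x y hx hy =>
      obtain ⟨a, ha⟩ := hx
      obtain ⟨b, hb⟩ := hy
      exact ⟨a + b, by rw [map_add, map_add, ha, hb]⟩
  exact { (inferInstance : IsHausdorff (IsLocalRing.maximalIdeal ℤ_[2]) M), hpre with }

theorem exists_pow_idempotent {S : Type*} [Monoid S] [Finite S] (a : S) :
    ∃ n, n ≠ 0 ∧ IsIdempotentElem (a ^ n) := by
  obtain ⟨m, n, hmn, h⟩ := Finite.exists_ne_map_eq_of_infinite fun n : ℕ => a ^ (n + 1)
  wlog hlt : m < n generalizing m n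
  · exact this n m hmn.symm h.symm (lt_of_le_of_ne (not_lt.1 hlt) hmn.symm)
  obtain ⟨k, rfl⟩ := Nat.exists_eq_add_of_lt hlt
  have h1 : ∀ j, m + 1 ≤ j → ∀ i, a ^ (j + i * (k + 1)) = a ^ j := by
    intro j hj i
    induction i with
    | zero => simp
    | succ i ih =>
      obtain ⟨l, rfl⟩ := Nat.exists_eq_add_of_le hj
      have e1 : m + 1 + l + (i + 1) * (k + 1) = (m + k + 1 + 1) + (l + i * (k + 1)) := by ring
      have e2 : m + 1 + l + i * (k + 1) = (m + 1) + (l + i * (k + 1)) := by ring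
      rw [e1, pow_add, ← h, ← pow_add, ← e2, ih]
  refine ⟨(m + 1) * (k + 1), by positivity, ?_⟩
  rw [IsIdempotentElem, ← pow_add]
  exact h1 _ (Nat.le_mul_of_pos_right _ (Nat.succ_pos k)) _

theorem eq_zero_of_idempotent {A : Type*} [CommRing A] {e : A} (he : e * e = e)
    (h : ∀ 𝔪 : MaximalSpectrum A, e ∈ 𝔪.asIdeal) : e = 0 := by
  have hu : IsUnit (1 - e) := by
    by_contra hn
    obtain ⟨𝔪, h𝔪, hmem⟩ := exists_max_ideal_of_mem_nonunits hn
    exact h𝔪.ne_top ((Ideal.eq_top_iff_one _).2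
      (by simpa using 𝔪.add_mem hmem (h ⟨𝔪, h𝔪⟩)))
  refine hu.mul_left_eq_zero.1 ?_
  rw [mul_sub, he, mul_one, sub_self]

theorem exists_idempotents (A : Type*) [CommRing A] [Algebra ℤ_[2] A] [Module.Finite ℤ_[2] A] :
    Finite (MaximalSpectrum A) ∧ ∃ e : MaximalSpectrum A → A, ∀ 𝔪, e 𝔪 * e 𝔪 = e 𝔪 ∧
      ∀ 𝔫 : MaximalSpectrum A, e 𝔪 ∈ 𝔫.asIdeal ↔ 𝔫 ≠ 𝔪 := by
  set I : Ideal A := (IsLocalRing.maximalIdeal ℤ_[2]).map (algebraMap ℤ_[2] A) with hI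
  have hc : IsAdicComplete I A := by
    rw [hI, IsAdicComplete.map_algebraMap_iff]
    exact isAdicComplete_of_finite A
  have hIm : ∀ 𝔪 : MaximalSpectrum A, I ≤ 𝔪.asIdeal := fun 𝔪 =>
    (IsAdicComplete.le_jacobson_bot I).trans (sInf_le ⟨bot_le, 𝔪.isMaximal⟩)
  have hfin : Finite (A ⧸ I) := by
    have h1 : Finite (ℤ_[2] ⧸ IsLocalRing.maximalIdeal ℤ_[2]) :=
      Finite.of_equiv _ (PadicInt.residueField (p := 2)).symm.toEquiv
    have h2 : Module.Finite (ℤ_[2] ⧸ IsLocalRing.maximalIdeal ℤ_[2]) (A ⧸ I) :=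
      Module.Finite.of_restrictScalars_finite ℤ_[2] _ _
    exact Module.finite_of_finite (ℤ_[2] ⧸ IsLocalRing.maximalIdeal ℤ_[2])
  have hfm : Finite (MaximalSpectrum A) := by
    refine Finite.of_injective (fun 𝔪 : MaximalSpectrum A =>
      ((𝔪.asIdeal.map (Ideal.Quotient.mk I) : Ideal (A ⧸ I)) : Set (A ⧸ I))) fun 𝔪 𝔫 h => ?_
    have h' := congrArg (Ideal.comap (Ideal.Quotient.mk I)) (SetLike.coe_injective h)
    rw [Ideal.comap_map_of_surjective' _ Ideal.Quotient.mk_surjective,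
      Ideal.comap_map_of_surjective' _ Ideal.Quotient.mk_surjective, Ideal.mk_ker,
      sup_eq_left.2 (hIm 𝔪), sup_eq_left.2 (hIm 𝔫)] at h'
    exact MaximalSpectrum.ext h'
  refine ⟨hfm, ?_⟩
  have key : ∀ 𝔪 : MaximalSpectrum A, ∃ e : A, e * e = e ∧
      ∀ 𝔫 : MaximalSpectrum A, e ∈ 𝔫.asIdeal ↔ 𝔫 ≠ 𝔪 := by
    intro 𝔪
    have h1 : ∀ 𝔫 : MaximalSpectrum A, ∃ x : A, x ∉ 𝔪.asIdeal ∧ (𝔫 ≠ 𝔪 → x ∈ 𝔫.asIdeal) := by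
      intro 𝔫
      by_cases h : 𝔫 = 𝔪
      · exact ⟨1, fun h1 => 𝔪.isMaximal.ne_top ((Ideal.eq_top_iff_one _).2 h1), fun h' => absurd h h'⟩
      · have : ¬ 𝔫.asIdeal ≤ 𝔪.asIdeal := fun hle =>
          h (MaximalSpectrum.ext (𝔫.isMaximal.eq_of_le 𝔪.isMaximal.ne_top hle))
        obtain ⟨x, hx, hx'⟩ := SetLike.not_le_iff_exists.1 this
        exact ⟨x, hx', fun _ => hx⟩
    choose x hx hx' using h1
    have := Fintype.ofFinite (MaximalSpectrum A)
    set a := ∏ 𝔫, x 𝔫 with ha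
    have ha1 : a ∉ 𝔪.asIdeal := fun h => by
      have := 𝔪.isMaximal.isPrime
      obtain ⟨𝔫, -, h⟩ := (Ideal.IsPrime.prod_mem_iff (p := 𝔪.asIdeal)).1 h
      exact hx 𝔫 h
    have ha2 : ∀ 𝔫 : MaximalSpectrum A, 𝔫 ≠ 𝔪 → a ∈ 𝔫.asIdeal := fun 𝔫 h =>
      Ideal.mem_of_dvd _ (Finset.dvd_prod_of_mem x (Finset.mem_univ 𝔫)) (hx' 𝔫 h)
    obtain ⟨n, hn, hidem⟩ := exists_pow_idempotent (Ideal.Quotient.mk I a)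
    have hb : a ^ n * a ^ n - a ^ n ∈ I := by
      rw [← Ideal.Quotient.eq, map_mul, map_pow]; exact hidem
    have hmon : (Polynomial.X ^ 2 - Polynomial.X : Polynomial A).Monic := by
      rcases subsingleton_or_nontrivial A with h | h
      · exact Polynomial.monic_of_subsingleton _
      · exact Polynomial.monic_X_pow_sub (by rw [Polynomial.degree_X]; norm_num)
    obtain ⟨e, he, hea⟩ := HenselianRing.is_henselian (I := I)
      (Polynomial.X ^ 2 - Polynomial.X : Polynomial A) hmon (a ^ n)
      (by simpa [pow_two] using hb) (by
        refine IsUnit.of_mul_eq_one (Ideal.Quotient.mk I (2 * a ^ n - 1)) ?_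
        rw [← map_mul, ← map_one (Ideal.Quotient.mk I), Ideal.Quotient.eq]
        simp only [Polynomial.derivative_sub, Polynomial.derivative_X_pow, Polynomial.derivative_X,
          Polynomial.eval_sub, Polynomial.eval_mul, Polynomial.eval_pow, Polynomial.eval_X,
          Polynomial.eval_one, Polynomial.eval_C]
        have e1 : ((2 : ℕ) : A) * (a ^ n) ^ (2 - 1) - 1 = 2 * a ^ n - 1 := by norm_num
        rw [e1]
        have e2 : (2 * a ^ n - 1) * (2 * a ^ n - 1) - 1 = 4 * (a ^ n * a ^ n - a ^ n) := by ring
        rw [e2]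
        exact I.mul_mem_left _ hb)
    refine ⟨e, ?_, fun 𝔫 => ?_⟩
    · have : e ^ 2 - e = 0 := by simpa [Polynomial.IsRoot] using he
      rw [← pow_two]; exact sub_eq_zero.1 this
    · have h2 : e ∈ 𝔫.asIdeal ↔ a ^ n ∈ 𝔫.asIdeal := by
        have := hIm 𝔫 hea
        exact ⟨fun h => by simpa using 𝔫.asIdeal.sub_mem h this,
          fun h => by simpa using 𝔫.asIdeal.add_mem this h⟩
      have := 𝔫.isMaximal.isPrime
      rw [h2, Ideal.IsPrime.pow_mem_iff_mem this n (Nat.pos_of_ne_zero hn)]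
      exact ⟨fun h h' => ha1 (h' ▸ h), ha2 𝔫⟩
  choose e he using key
  exact ⟨e, he⟩

theorem comparison {A M : Type*} [CommRing A] [Algebra ℤ_[2] A] [Module.Finite ℤ_[2] A]
    [AddCommGroup M] [Module A M] (u : A) :
    (∀ m : M, (∀ 𝔪 : MaximalSpectrum A, u ∈ 𝔪.asIdeal →
        LocalizedModule.mkLinearMap 𝔪.asIdeal.primeCompl M m = 0) →
      (1 : (𝔪 : {𝔪 : MaximalSpectrum A // u ∉ 𝔪.asIdeal}) →
        Localization.AtPrime 𝔪.1.asIdeal) ⊗ₜ[A] m = 0 → m = 0) ∧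
    (∀ z : ((𝔪 : {𝔪 : MaximalSpectrum A // u ∉ 𝔪.asIdeal}) →
        Localization.AtPrime 𝔪.1.asIdeal) ⊗[A] M, ∃ m : M,
      (∀ 𝔪 : MaximalSpectrum A, u ∈ 𝔪.asIdeal →
        LocalizedModule.mkLinearMap 𝔪.asIdeal.primeCompl M m = 0) ∧ 1 ⊗ₜ[A] m = z) := by
  obtain ⟨hfin, e, he⟩ := exists_idempotents A
  have := Fintype.ofFinite (MaximalSpectrum A)
  classical
  have hone : ∀ 𝔪, e 𝔪 ∉ 𝔪.asIdeal := fun 𝔪 h => ((he 𝔪).2 𝔪).1 h rfl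
  have horth : ∀ 𝔪 𝔫, 𝔪 ≠ 𝔫 → e 𝔪 * e 𝔫 = 0 := fun 𝔪 𝔫 h => by
    refine eq_zero_of_idempotent (by rw [mul_mul_mul_comm, (he 𝔪).1, (he 𝔫).1]) fun 𝔩 => ?_
    by_cases h1 : 𝔩 = 𝔪
    · exact 𝔩.asIdeal.mul_mem_left _ (((he 𝔫).2 𝔩).2 (h1 ▸ h))
    · exact 𝔩.asIdeal.mul_mem_right _ (((he 𝔪).2 𝔩).2 h1)
  -- an element outside a maximal ideal is invertible on the corresponding component
  have hinv : ∀ (𝔪 : MaximalSpectrum A) (s : A), s ∉ 𝔪.asIdeal →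
      ∃ v, v * s * e 𝔪 = e 𝔪 := fun 𝔪 s hs => by
    have hu : IsUnit (s * e 𝔪 + (1 - e 𝔪)) := by
      by_contra hn
      obtain ⟨𝔫, h𝔫, hmem⟩ := exists_max_ideal_of_mem_nonunits hn
      have hp := h𝔫.isPrime
      have h0 : e 𝔪 * (1 - e 𝔪) = 0 := by rw [mul_sub, (he 𝔪).1, mul_one, sub_self]
      by_cases h1 : (⟨𝔫, h𝔫⟩ : MaximalSpectrum A) = 𝔪
      · have h2 : e 𝔪 ∉ 𝔫 := by
          have := hone 𝔪; rw [← h1] at this ⊢; exact this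
        have h3 : s ∉ 𝔫 := by rw [← h1] at hs; exact hs
        have h4 : 1 - e 𝔪 ∈ 𝔫 := ((hp.mem_or_mem (h0 ▸ 𝔫.zero_mem)).resolve_left h2)
        have h5 : s * e 𝔪 ∈ 𝔫 := by simpa using 𝔫.sub_mem hmem h4
        exact (hp.mem_or_mem h5).elim h3 h2
      · have h2 : e 𝔪 ∈ 𝔫 := ((he 𝔪).2 ⟨𝔫, h𝔫⟩).2 h1
        refine h𝔫.ne_top ((Ideal.eq_top_iff_one _).2 ?_)
        have : (1 : A) = (s * e 𝔪 + (1 - e 𝔪)) - s * e 𝔪 + e 𝔪 := by ring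
        rw [this]
        exact 𝔫.add_mem (𝔫.sub_mem hmem (𝔫.mul_mem_left _ h2)) h2
    obtain ⟨y, hu⟩ := hu
    refine ⟨(y⁻¹ : Aˣ), ?_⟩
    have h1 : s * e 𝔪 = y * e 𝔪 := by
      rw [hu, add_mul, sub_mul, mul_assoc, (he 𝔪).1, one_mul, sub_self, add_zero]
    rw [mul_assoc, h1, Units.inv_mul_cancel_left]
  have hloc : ∀ (𝔪 : MaximalSpectrum A) (m : M), e 𝔪 • m = 0 →
      LocalizedModule.mkLinearMap 𝔪.asIdeal.primeCompl M m = 0 := fun 𝔪 m h =>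
    (IsLocalizedModule.eq_zero_iff 𝔪.asIdeal.primeCompl _).2 ⟨⟨e 𝔪, hone 𝔪⟩, h⟩
  have halg : ∀ (𝔪 : MaximalSpectrum A) (a b : A), e 𝔪 * a = e 𝔪 * b →
      algebraMap _ (Localization.AtPrime 𝔪.asIdeal) a =
        algebraMap _ (Localization.AtPrime 𝔪.asIdeal) b := fun 𝔪 a b h =>
    (IsLocalization.eq_iff_exists 𝔪.asIdeal.primeCompl _).2 ⟨⟨e 𝔪, hone 𝔪⟩, h⟩
  have hsurj : Function.Surjective (algebraMap A ((𝔪 : {𝔪 : MaximalSpectrum A // u ∉ 𝔪.asIdeal}) →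
      Localization.AtPrime 𝔪.1.asIdeal)) := by
    intro x
    have h1 : ∀ 𝔪 : {𝔪 : MaximalSpectrum A // u ∉ 𝔪.asIdeal}, ∃ a, algebraMap A _ a = x 𝔪 := fun 𝔪 => by
      obtain ⟨b, s, hbs⟩ := IsLocalization.exists_mk'_eq 𝔪.1.asIdeal.primeCompl (x 𝔪)
      obtain ⟨v, hv⟩ := hinv 𝔪.1 s s.2
      refine ⟨v * b, ?_⟩
      rw [← hbs, IsLocalization.eq_mk'_iff_mul_eq, ← map_mul]
      exact halg 𝔪.1 _ _ (by linear_combination b * hv)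
    choose a ha using h1
    refine ⟨∑ 𝔪 : {𝔪 : MaximalSpectrum A // u ∉ 𝔪.asIdeal}, e 𝔪.1 * a 𝔪, funext fun 𝔫 => ?_⟩
    rw [← ha 𝔫]
    refine halg 𝔫.1 (∑ 𝔪 : {𝔪 : MaximalSpectrum A // u ∉ 𝔪.asIdeal}, e 𝔪.1 * a 𝔪) (a 𝔫) ?_
    rw [Finset.mul_sum, Finset.sum_eq_single 𝔫, ← mul_assoc, (he 𝔫.1).1]
    · intro 𝔪 _ h
      rw [← mul_assoc, horth _ _ fun h' => h (Subtype.ext h'.symm), zero_mul]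
    · exact fun h => absurd (Finset.mem_univ _) h
  set E : A := ∑ 𝔪 : {𝔪 : MaximalSpectrum A // u ∉ 𝔪.asIdeal}, e 𝔪.1 with hE
  have hE1 : algebraMap A ((𝔪 : {𝔪 : MaximalSpectrum A // u ∉ 𝔪.asIdeal}) →
      Localization.AtPrime 𝔪.1.asIdeal) E = 1 := by
    funext 𝔫
    refine (halg 𝔫.1 E 1 ?_).trans (map_one _)
    rw [hE, Finset.mul_sum, Finset.sum_eq_single 𝔫, (he 𝔫.1).1, mul_one]
    · exact fun 𝔪 _ h => horth _ _ fun h' => h (Subtype.ext h'.symm)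
    · exact fun h => absurd (Finset.mem_univ _) h
  have hE0 : ∀ (m : M) (𝔪 : MaximalSpectrum A), u ∈ 𝔪.asIdeal →
      LocalizedModule.mkLinearMap 𝔪.asIdeal.primeCompl M (E • m) = 0 := fun m 𝔪 h𝔪 => by
    refine hloc 𝔪 _ ?_
    rw [← mul_smul, hE, Finset.mul_sum, Finset.sum_eq_zero, zero_smul]
    exact fun 𝔫 _ => horth _ _ fun h => 𝔫.2 (h ▸ h𝔪)
  refine ⟨fun m hm h => ?_, fun z => ?_⟩
  · refine Module.eq_zero_of_localization_maximal
      (fun (𝔪 : Ideal A) [𝔪.IsMaximal] => LocalizedModule 𝔪.primeCompl M)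
      (fun (𝔪 : Ideal A) [𝔪.IsMaximal] => LocalizedModule.mkLinearMap 𝔪.primeCompl M) _ fun 𝔪 h𝔪 => ?_
    by_cases hU : u ∈ 𝔪
    · exact hm ⟨𝔪, h𝔪⟩ hU
    · let π : ((𝔪 : {𝔪 : MaximalSpectrum A // u ∉ 𝔪.asIdeal}) →
          Localization.AtPrime 𝔪.1.asIdeal) →ₗ[A] Localization.AtPrime 𝔪 :=
        LinearMap.proj (⟨⟨𝔪, h𝔪⟩, hU⟩ : {𝔪 : MaximalSpectrum A // u ∉ 𝔪.asIdeal})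
      have h1 : (1 : Localization.AtPrime 𝔪) ⊗ₜ[A] m = 0 :=
        (congrArg (π.rTensor M) h).trans (map_zero _)
      have h2 := congrArg (LocalizedModule.equivTensorProduct 𝔪.primeCompl M).symm h1
      rw [map_zero, LocalizedModule.equivTensorProduct_symm_apply_tmul_one] at h2
      exact h2
  · have h1 : ∃ m : M, (1 : (𝔪 : {𝔪 : MaximalSpectrum A // u ∉ 𝔪.asIdeal}) →
        Localization.AtPrime 𝔪.1.asIdeal) ⊗ₜ[A] m = z := by
      induction z using TensorProduct.induction_on with
      | zero => exact ⟨0, TensorProduct.tmul_zero _ _⟩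
      | tmul x m =>
        obtain ⟨a, rfl⟩ := hsurj x
        exact ⟨a • m, by rw [← TensorProduct.smul_tmul, Algebra.algebraMap_eq_smul_one]⟩
      | add x y hx hy =>
        obtain ⟨a, ha⟩ := hx
        obtain ⟨b, hb⟩ := hy
        exact ⟨a + b, by rw [TensorProduct.tmul_add, ha, hb]⟩
    obtain ⟨m, rfl⟩ := h1
    refine ⟨E • m, hE0 m, ?_⟩
    rw [← TensorProduct.smul_tmul, ← Algebra.algebraMap_eq_smul_one, hE1]

variable {M : Type*} [AddCommGroup M] [Module ℤ_[2] M]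

/-- `Aᵒʳᵈ`: the product of the local rings `A_𝔪` of `A` in which the image of `U` is a unit. -/
abbrev OrdAlgebra (U : Module.End ℤ_[2] M) : Type _ :=
  (𝔪 : {𝔪 : MaximalSpectrum (opAlgebra U) // opElem U ∉ 𝔪.asIdeal}) →
    Localization.AtPrime 𝔪.1.asIdeal

theorem opAlgebra_finite [Module.Finite ℤ_[2] M] (U : Module.End ℤ_[2] M) :
    Module.Finite ℤ_[2] (opAlgebra U) := by
  obtain ⟨n, g, hg⟩ := Module.Finite.exists_fin (R := ℤ_[2]) (M := M)
  let f : opAlgebra U →ₗ[ℤ_[2]] (Fin n → M) :=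
    LinearMap.pi fun i => (LinearMap.applyₗ (g i)).comp (opAlgebra U).val.toLinearMap
  refine Module.Finite.of_injective f fun a b hab => Subtype.ext ?_
  refine LinearMap.ext_on_range hg fun i => congrFun hab i

/-- The ordinary part of `M`, as a submodule of `M`, is `Aᵒʳᵈ ⊗_A M`. -/
theorem ordinaryPart_bijective [Module.Finite ℤ_[2] M] (U : Module.End ℤ_[2] M) :
    Function.Bijective fun m : ordinaryPart U =>
      (1 : OrdAlgebra U) ⊗ₜ[opAlgebra U] (m : M) := by
  have := opAlgebra_finite U
  obtain ⟨h1, h2⟩ := comparison (A := opAlgebra U) (M := M) (opElem U)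
  constructor
  · intro m m' h
    refine Subtype.ext (sub_eq_zero.1 (h1 _ ((ordinaryPart U).sub_mem m.2 m'.2) ?_))
    exact (TensorProduct.tmul_sub _ _ _).trans (sub_eq_zero.2 h)
  · intro z
    obtain ⟨m, hm, rfl⟩ := h2 z
    exact ⟨⟨m, hm⟩, rfl⟩

end Comparison

/-! ### Hecke operators -/

section Hecke

variable {T : Type*} [Group T]

/-- The subgroup `t⁻¹Ht ∩ G` of `G`. -/
def heckeSubgroup (G H : Subgroup T) (t : T) : Subgroup G :=
  (H.comap (MulAut.conj t).toMonoidHom).subgroupOf G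

/-- Conjugation by `t`, from `t⁻¹Ht ∩ G` to `H ∩ tGt⁻¹`, followed by the inclusion into `H`. -/
def heckeConj (G H : Subgroup T) (t : T) : heckeSubgroup G H t →* H :=
  ((MulAut.conj t).toMonoidHom.comp (G.subtype.comp (heckeSubgroup G H t).subtype)).codRestrict H
    fun x => x.2

/-- The Hecke operator `[t] : Gᵃᵇ → Hᵃᵇ`: the transfer `Gᵃᵇ → (t⁻¹Ht ∩ G)ᵃᵇ`, followed by the map
to `Hᵃᵇ` induced by conjugation by `t`. -/
def heckeOperator (G H : Subgroup T) (t : T) [(heckeSubgroup G H t).FiniteIndex] :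
    Abelianization G →* Abelianization H :=
  (Abelianization.map (heckeConj G H t)).comp
    (Abelianization.lift
      (MonoidHom.transfer (Abelianization.of : heckeSubgroup G H t →* _)))

theorem transfer_eq_prod {G A : Type*} [Group G] [CommGroup A] (K : Subgroup G) [K.FiniteIndex]
    (ϕ : K →* A) (σ : G ⧸ K → G) (hσ : ∀ q, (σ q : G ⧸ K) = q) (g : G)
    (hmem : ∀ q, (σ q)⁻¹ * (g * σ (g⁻¹ • q)) ∈ K) :
    MonoidHom.transfer ϕ g = let _ := K.fintypeQuotientOfFiniteIndex
      ∏ q, ϕ ⟨(σ q)⁻¹ * (g * σ (g⁻¹ • q)), hmem q⟩ := by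
  let S : K.LeftTransversal := ⟨Set.range σ, Subgroup.isComplement_range_left hσ⟩
  have hS : ∀ q, (S.2.leftQuotientEquiv q : G) = σ q := fun q =>
    Subgroup.IsComplement.leftQuotientEquiv_apply hσ q
  rw [MonoidHom.transfer_def ϕ S g, Subgroup.leftTransversals.diff]
  refine Finset.prod_congr rfl fun q _ => congrArg ϕ (Subtype.ext ?_)
  change (S.2.leftQuotientEquiv q : G)⁻¹ * ((g • S).2.leftQuotientEquiv q : G) = _
  rw [Subgroup.smul_apply_eq_smul_apply_inv_smul, hS, hS, smul_eq_mul]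

theorem transfer_conj {G A : Type*} [Group G] [CommGroup A] (K : Subgroup G) [K.FiniteIndex]
    (ϕ : K →* A) (e : G ≃* G) (he : ∀ g, g ∈ K → e g ∈ K) (he' : ∀ g, e g ∈ K → g ∈ K)
    (θ : A →* A) (h : ∀ k : K, ϕ ⟨e k, he _ k.2⟩ = θ (ϕ k)) (g : G) :
    MonoidHom.transfer ϕ (e g) = θ (MonoidHom.transfer ϕ g) := by
  let _ := K.fintypeQuotientOfFiniteIndex
  let E : G ⧸ K ≃ G ⧸ K :=
    { toFun := Quotient.map' e fun a b hab => by
        rw [QuotientGroup.leftRel_apply] at hab ⊢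
        rw [← map_inv, ← map_mul]; exact he _ hab
      invFun := Quotient.map' e.symm fun a b hab => by
        rw [QuotientGroup.leftRel_apply] at hab ⊢
        refine he' _ ?_
        rwa [map_mul, map_inv, e.apply_symm_apply, e.apply_symm_apply]
      left_inv := fun q => by
        induction q using QuotientGroup.induction_on with
        | H x => exact congrArg QuotientGroup.mk (e.symm_apply_apply x)
      right_inv := fun q => by
        induction q using QuotientGroup.induction_on with
        | H x => exact congrArg QuotientGroup.mk (e.apply_symm_apply x) }
  have hE : ∀ x : G, E (x : G ⧸ K) = (e x : G) := fun x => rfl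
  have hEs : ∀ (x : G) (q : G ⧸ K), E (x • q) = e x • E q := fun x q => by
    induction q using QuotientGroup.induction_on with
    | H y => exact congrArg QuotientGroup.mk (map_mul e x y)
  let σ : G ⧸ K → G := Quotient.out
  have hσ : ∀ q, (σ q : G ⧸ K) = q := fun q => Quotient.out_eq' q
  let τ : G ⧸ K → G := fun q => e (σ (E.symm q))
  have hτ : ∀ q, (τ q : G ⧸ K) = q := fun q => by
    rw [← hE, hσ, E.apply_symm_apply]
  have hmem : ∀ (ρ : G ⧸ K → G) (_ : ∀ q, (ρ q : G ⧸ K) = q) (x : G) (q : G ⧸ K),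
      (ρ q)⁻¹ * (x * ρ (x⁻¹ • q)) ∈ K := fun ρ hρ x q => by
    rw [← QuotientGroup.eq, hρ, ← smul_eq_mul, ← MulAction.Quotient.smul_coe, hρ, smul_inv_smul]
  rw [transfer_eq_prod K ϕ τ hτ (e g) (hmem τ hτ _), transfer_eq_prod K ϕ σ hσ g (hmem σ hσ _),
    map_prod]
  refine (Fintype.prod_equiv E _ _ fun q => ?_).symm
  rw [← h]
  refine congrArg ϕ (Subtype.ext ?_)
  change e ((σ q)⁻¹ * (g * σ (g⁻¹ • q))) = (e (σ (E.symm (E q))))⁻¹ *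
    (e g * e (σ (E.symm ((e g)⁻¹ • E q))))
  rw [← map_inv e g, ← hEs, E.symm_apply_apply, E.symm_apply_apply, map_mul, map_inv, map_mul]

end Hecke

/-! ### The groups `Γ` and `Γ_r`, and the Iwasawa algebra -/

/-- The index set of the tower. -/
abbrev Level : Type := {r : ℕ // 2 ≤ r}

/-- `Γ_r`, the kernel of `ℤ₂ˣ → (ℤ₂/2^r)ˣ`. -/
def padicSubgroup (r : ℕ) : Subgroup ℤ_[2]ˣ :=
  (Units.map (PadicInt.toZModPow r : ℤ_[2] →+* ZMod (2 ^ r)).toMonoidHom).ker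

theorem mem_padicSubgroup {r : ℕ} {x : ℤ_[2]ˣ} :
    x ∈ padicSubgroup r ↔ PadicInt.toZModPow r (x : ℤ_[2]) = 1 := by
  rw [padicSubgroup, MonoidHom.mem_ker, Units.ext_iff]; rfl

theorem padicSubgroup_anti {s r : ℕ} (h : s ≤ r) : padicSubgroup r ≤ padicSubgroup s := by
  intro x hx
  rw [mem_padicSubgroup] at hx ⊢
  rw [← PadicInt.zmod_cast_comp_toZModPow s r h, RingHom.comp_apply, hx, map_one]

/-- `Γ = Γ₂ = 1 + 4ℤ₂`. -/
abbrev Gam : Type := padicSubgroup 2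

/-- `Γ_r` as a subgroup of `Γ`. -/
abbrev gamSub (r : ℕ) : Subgroup Gam := (padicSubgroup r).subgroupOf (padicSubgroup 2)

/-- The quotient `Γ/Γ_r`. -/
def GamQuot (r : ℕ) : Type := Gam ⧸ gamSub r

instance (r : ℕ) : CommGroup (GamQuot r) := QuotientGroup.Quotient.commGroup (gamSub r)

/-- The projection `Γ → Γ/Γ_r`. -/
def gamMk (r : ℕ) : Gam →* GamQuot r := QuotientGroup.mk' (gamSub r)

theorem gamMk_surjective (r : ℕ) : Function.Surjective (gamMk r) :=
  QuotientGroup.mk'_surjective _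

theorem gamMk_eq {r : ℕ} {x y : Gam} : gamMk r x = gamMk r y ↔
    PadicInt.toZModPow r ((x : ℤ_[2]ˣ) : ℤ_[2]) = PadicInt.toZModPow r ((y : ℤ_[2]ˣ) : ℤ_[2]) := by
  refine QuotientGroup.eq.trans ?_
  rw [Subgroup.mem_subgroupOf, padicSubgroup, MonoidHom.mem_ker]
  rw [Subgroup.coe_mul, Subgroup.coe_inv, map_mul, map_inv, inv_mul_eq_one, Units.ext_iff]
  rfl

/-- The projection `Γ/Γ_r → Γ/Γ_s` for `s ≤ r`. -/
def gamProj {s r : ℕ} (h : s ≤ r) : GamQuot r →* GamQuot s :=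
  QuotientGroup.map _ _ (MonoidHom.id _) fun _ hx => padicSubgroup_anti h hx

theorem gamProj_mk {s r : ℕ} (h : s ≤ r) (x : Gam) : gamProj h (gamMk r x) = gamMk s x := rfl

/-- The group ring `ℤ₂[Γ/Γ_r]`. -/
abbrev GroupRing (r : ℕ) : Type := MonoidAlgebra ℤ_[2] (GamQuot r)

/-- The projection `ℤ₂[Γ/Γ_r] → ℤ₂[Γ/Γ_s]` for `s ≤ r`. -/
def groupRingProj {s r : ℕ} (h : s ≤ r) : GroupRing r →ₐ[ℤ_[2]] GroupRing s :=
  MonoidAlgebra.mapDomainAlgHom ℤ_[2] ℤ_[2] (gamProj h)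

/-- The Iwasawa algebra `Λ = ℤ₂[[Γ]]`, the inverse limit of the rings `ℤ₂[Γ/Γ_r]`, `r ≥ 2`. -/
def iwasawaSubalgebra : Subalgebra ℤ_[2] ((r : Level) → GroupRing r) where
  carrier := {f | ∀ (r s : Level) (h : s.1 ≤ r.1), groupRingProj h (f r) = f s}
  mul_mem' := fun {a b} ha hb r s h => by
    change groupRingProj h (a r * b r) = a s * b s
    rw [map_mul, ha r s h, hb r s h]
  add_mem' := fun {a b} ha hb r s h => by
    change groupRingProj h (a r + b r) = a s + b s
    rw [map_add, ha r s h, hb r s h]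
  algebraMap_mem' := fun c r s h => (groupRingProj h).commutes c

/-- The Iwasawa algebra `Λ` as a type. -/
def Iwasawa : Type := iwasawaSubalgebra

instance : CommRing Iwasawa := inferInstanceAs (CommRing iwasawaSubalgebra)

instance : Algebra ℤ_[2] Iwasawa := inferInstanceAs (Algebra ℤ_[2] iwasawaSubalgebra)

/-- The projection `Λ → ℤ₂[Γ/Γ_r]`. -/
def iwasawaProj (r : Level) : Iwasawa →ₐ[ℤ_[2]] GroupRing r :=
  (Pi.evalAlgHom ℤ_[2] (fun r : Level => GroupRing r) r).comp
    iwasawaSubalgebra.val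

/-- The augmentation ideal `𝔞_r` of `Γ_r` in `Λ`: the kernel of `Λ → ℤ₂[Γ/Γ_r]`. -/
def augIdeal (r : Level) : Ideal Iwasawa := RingHom.ker (iwasawaProj r)

/-- The canonical homomorphism `Γ → Λ`. -/
def iwasawaOf : Gam →* Iwasawa where
  toFun g := ⟨fun r => MonoidAlgebra.of ℤ_[2] (GamQuot r) (gamMk r g), fun r s h => by
    change MonoidAlgebra.mapDomain (gamProj h) (MonoidAlgebra.single (gamMk r g) 1)
      = MonoidAlgebra.single (gamMk s g) 1
    rw [MonoidAlgebra.mapDomain_single, gamProj_mk]⟩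
  map_one' := Subtype.ext (funext fun r =>
    (congrArg (MonoidAlgebra.of ℤ_[2] (GamQuot r)) (map_one (gamMk r))).trans (map_one _))
  map_mul' a b := Subtype.ext (funext fun r =>
    (congrArg (MonoidAlgebra.of ℤ_[2] (GamQuot r)) (map_mul (gamMk r) a b)).trans (map_mul _ _ _))

/-! ### The congruence subgroups and the operator `U` -/

/-- `Γ₁(N2^r)`, as a subgroup of `GL₂(ℚ)`. -/
def levelGroup (N r : ℕ) : Subgroup (GL (Fin 2) ℚ) :=
  (CongruenceSubgroup.Gamma1 (N * 2 ^ r)).map (Matrix.SpecialLinearGroup.mapGL ℚ)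

theorem levelGroup_anti (N : ℕ) {s r : ℕ} (h : s ≤ r) : levelGroup N r ≤ levelGroup N s := by
  refine Subgroup.map_mono fun A hA => ?_
  rw [CongruenceSubgroup.Gamma1_mem] at hA ⊢
  have hd : N * 2 ^ s ∣ N * 2 ^ r := mul_dvd_mul_left N (pow_dvd_pow 2 h)
  have hc : ∀ x y : ℤ, (x : ZMod (N * 2 ^ r)) = y → (x : ZMod (N * 2 ^ s)) = y := fun x y hxy => by
    rw [ZMod.intCast_eq_intCast_iff_dvd_sub] at hxy ⊢
    exact (Int.natCast_dvd_natCast.2 hd).trans hxy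
  exact ⟨by simpa using hc (A 0 0) 1 (by simpa using hA.1),
    by simpa using hc (A 1 1) 1 (by simpa using hA.2.1),
    by simpa using hc (A 1 0) 0 (by simpa using hA.2.2)⟩

/-- `Φ_r = Γ₁(4N) ∩ Γ₀(2^r)`. -/
def phiGroup (N r : ℕ) : Subgroup SL(2, ℤ) :=
  CongruenceSubgroup.Gamma1 (N * 2 ^ 2) ⊓ CongruenceSubgroup.Gamma0 (2 ^ r)

theorem isUnit_of_int (d : ℤ) (hd : (d : ZMod (2 ^ 2)) = 1) : IsUnit (d : ℤ_[2]) := by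
  by_contra h
  rw [PadicInt.not_isUnit_iff, PadicInt.norm_int_lt_one_iff_dvd] at h
  have h4 : ((2 ^ 2 : ℕ) : ℤ) ∣ 1 - d := by
    rw [← ZMod.intCast_eq_intCast_iff_dvd_sub, hd, Int.cast_one]
  norm_num at h h4
  omega

/-- An integer `d ≡ 1 mod 4`, as an element of `Γ`. -/
def gamOfInt (d : ℤ) (hd : (d : ZMod (2 ^ 2)) = 1) : Gam :=
  ⟨IsUnit.unit (a := (d : ℤ_[2])) (isUnit_of_int d hd), by
    rw [mem_padicSubgroup, IsUnit.unit_spec, map_intCast, hd]⟩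

theorem toZModPow_gamOfInt (r : ℕ) (d : ℤ) (hd : (d : ZMod (2 ^ 2)) = 1) :
    PadicInt.toZModPow r ((gamOfInt d hd : ℤ_[2]ˣ) : ℤ_[2]) = d := by
  rw [gamOfInt, IsUnit.unit_spec, map_intCast]

theorem phiGroup_entry {N r : ℕ} (α : phiGroup N r) : ((α.1 1 1 : ℤ) : ZMod (2 ^ 2)) = 1 := by
  have h := ((CongruenceSubgroup.Gamma1_mem _ _).1 α.2.1).2.1
  generalize α.1 1 1 = d at h ⊢
  rw [← Int.cast_one, ZMod.intCast_eq_intCast_iff_dvd_sub] at h ⊢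
  exact (Int.natCast_dvd_natCast.2 (dvd_mul_left _ _)).trans h

/-- The homomorphism `η_r : Φ_r → Γ/Γ_r`, sending `(a b; c d)` to the class of `d`. -/
def eta (N r : ℕ) : phiGroup N r →* GamQuot r where
  toFun α := gamMk r (gamOfInt (α.1 1 1) (phiGroup_entry α))
  map_one' := by
    rw [← map_one (gamMk r), gamMk_eq, toZModPow_gamOfInt]; simp
  map_mul' α β := by
    have h0 : ((α.1 1 0 : ℤ) : ZMod (2 ^ r)) = 0 := CongruenceSubgroup.Gamma0_mem.1 α.2.2
    have h1 : (α * β).1 1 1 = α.1 1 0 * β.1 0 1 + α.1 1 1 * β.1 1 1 := by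
      change (α.1.1 * β.1.1) 1 1 = _
      rw [Matrix.mul_apply, Fin.sum_univ_two]
    rw [← map_mul, gamMk_eq, toZModPow_gamOfInt, h1]
    change _ = PadicInt.toZModPow r (((gamOfInt _ (phiGroup_entry α) : ℤ_[2]ˣ) : ℤ_[2]) *
      ((gamOfInt _ (phiGroup_entry β) : ℤ_[2]ˣ) : ℤ_[2]))
    rw [map_mul, toZModPow_gamOfInt, toZModPow_gamOfInt, Int.cast_add, Int.cast_mul, Int.cast_mul,
      h0, zero_mul, zero_add]

theorem eta_eq_iff {N r : ℕ} (α : phiGroup N r) (x : Gam) : eta N r α = gamMk r x ↔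
    ((α.1 1 1 : ℤ) : ZMod (2 ^ r)) = PadicInt.toZModPow r ((x : ℤ_[2]ˣ) : ℤ_[2]) := by
  refine gamMk_eq.trans ?_
  rw [toZModPow_gamOfInt]

theorem eta_surjective (N : ℕ) [Fact (Nat.Coprime 2 N)] (r : Level) (x : GamQuot r) :
    ∃ α : phiGroup N r, eta N r α = x ∧ 2 ∣ α.1 0 1 := by
  obtain ⟨y, rfl⟩ := gamMk_surjective r x
  obtain ⟨v, hv⟩ : ∃ v : ℤ, (v : ZMod (2 ^ r.1)) =
      PadicInt.toZModPow r ((y : ℤ_[2]ˣ) : ℤ_[2]) := ZMod.intCast_surjective _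
  have hN : Nat.Coprime 2 N := Fact.out
  have hv4 : (2 ^ 2 : ℤ) ∣ v - 1 := by
    have h1 : (v : ZMod (2 ^ 2)) = 1 := by
      have := PadicInt.cast_toZModPow 2 r.1 r.2 ((y : ℤ_[2]ˣ) : ℤ_[2])
      rw [← hv, mem_padicSubgroup.1 y.2, ZMod.cast_intCast (pow_dvd_pow 2 r.2)] at this
      exact this
    have := (ZMod.intCast_eq_intCast_iff_dvd_sub 1 v (2 ^ 2)).1 (by rw [h1, Int.cast_one])
    simpa using this
  have hco : IsCoprime ((2 : ℤ) ^ r.1) N :=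
    IsCoprime.pow_left (by exact_mod_cast Nat.isCoprime_iff_coprime.2 hN)
  obtain ⟨u, w, huw⟩ := hco
  set d : ℤ := v + (1 - v) * u * 2 ^ r.1 with hd
  have hd2 : (2 ^ r.1 : ℤ) ∣ d - v := ⟨(1 - v) * u, by rw [hd]; ring⟩
  have hdN : (N : ℤ) ∣ d - 1 := ⟨(v - 1) * w, by rw [hd]; linear_combination (1 - v) * huw⟩
  have hd4 : (2 ^ 2 : ℤ) ∣ d - 1 := by
    have := dvd_add ((pow_dvd_pow (2 : ℤ) r.2).trans hd2) hv4
    simpa using this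
  have hcop4 : IsCoprime (N : ℤ) (2 ^ 2) :=
    IsCoprime.pow_right (by exact_mod_cast Nat.isCoprime_iff_coprime.2 hN.symm)
  have hdN4 : (N * 2 ^ 2 : ℤ) ∣ d - 1 := hcop4.mul_dvd hdN hd4
  have hdc : IsCoprime d (2 * (N * 2 ^ r.1)) := by
    have h1 : IsCoprime d (N : ℤ) := by
      obtain ⟨k, hk⟩ := hdN
      exact ⟨1, -k, by linear_combination hk⟩
    have h2 : IsCoprime d (2 : ℤ) := by
      obtain ⟨k, hk⟩ := hd4
      exact ⟨1, -2 * k, by linear_combination hk⟩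
    exact h2.mul_right (h1.mul_right h2.pow_right)
  obtain ⟨a, b, hab⟩ := hdc
  have hdet : (!![a, -2 * b; N * 2 ^ r.1, d] : Matrix (Fin 2) (Fin 2) ℤ).det = 1 := by
    rw [Matrix.det_fin_two_of]; linear_combination hab
  have hc4 : (N * 2 ^ 2 : ℤ) ∣ N * 2 ^ r.1 := mul_dvd_mul_left _ (pow_dvd_pow 2 r.2)
  have ha4 : (N * 2 ^ 2 : ℤ) ∣ a - 1 := by
    have : a - 1 = -a * (d - 1) - 2 * b * (N * 2 ^ r.1) := by linear_combination hab
    rw [this]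
    exact dvd_sub (hdN4.mul_left _) (hc4.mul_left _)
  have hz : ∀ x : ℤ, (N * 2 ^ 2 : ℤ) ∣ x - 1 → (x : ZMod (N * 2 ^ 2)) = 1 := fun x hx => by
    have := (ZMod.intCast_eq_intCast_iff_dvd_sub 1 x (N * 2 ^ 2)).2 (by push_cast; exact hx)
    rw [← this, Int.cast_one]
  refine ⟨⟨⟨!![a, -2 * b; N * 2 ^ r.1, d], hdet⟩, ?_, ?_⟩, ?_, ?_⟩
  · refine (CongruenceSubgroup.Gamma1_mem _ _).2 ⟨hz a ha4, hz d hdN4, ?_⟩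
    exact (ZMod.intCast_zmod_eq_zero_iff_dvd _ _).2 (by push_cast; exact hc4)
  · refine CongruenceSubgroup.Gamma0_mem.2 ?_
    exact (ZMod.intCast_zmod_eq_zero_iff_dvd _ _).2 (by
      push_cast; exact dvd_mul_left ((2 : ℤ) ^ r.1) (N : ℤ))
  · rw [eta_eq_iff, ← hv]
    exact ((ZMod.intCast_eq_intCast_iff_dvd_sub v d (2 ^ r.1)).2 (by push_cast; exact hd2)).symm
  · exact ⟨-b, by change -2 * b = _; ring⟩

theorem mem_levelGroup_iff (N : ℕ) [Fact (Nat.Coprime 2 N)] (r : Level) (A : SL(2, ℤ)) :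
    Matrix.SpecialLinearGroup.mapGL ℚ A ∈ levelGroup N r ↔
      ∃ h : A ∈ phiGroup N r, eta N r ⟨A, h⟩ = 1 := by
  have hmap : Matrix.SpecialLinearGroup.mapGL ℚ A ∈ levelGroup N r ↔
      A ∈ CongruenceSubgroup.Gamma1 (N * 2 ^ r.1) :=
    Subgroup.mem_map_iff_mem Matrix.SpecialLinearGroup.mapGL_injective
  have hN : Nat.Coprime 2 N := Fact.out
  have hcop : ∀ k : ℕ, IsCoprime (N : ℤ) (2 ^ k) := fun k =>
    IsCoprime.pow_right (by exact_mod_cast Nat.isCoprime_iff_coprime.2 hN.symm)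
  have h1 : ∀ (n : ℕ) (x : ℤ), (x : ZMod n) = 1 ↔ (n : ℤ) ∣ x - 1 := fun n x => by
    rw [eq_comm, ← Int.cast_one, ZMod.intCast_eq_intCast_iff_dvd_sub]
  have h0 : ∀ (n : ℕ) (x : ℤ), (x : ZMod n) = 0 ↔ (n : ℤ) ∣ x := fun n x =>
    ZMod.intCast_zmod_eq_zero_iff_dvd _ _
  have hdiv : ∀ (k : ℕ) (x : ℤ), ((N * 2 ^ k : ℕ) : ℤ) ∣ x ↔ (N : ℤ) ∣ x ∧ (2 ^ k : ℤ) ∣ x :=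
    fun k x => by
      push_cast
      exact ⟨fun h => ⟨(dvd_mul_right _ _).trans h, (dvd_mul_left _ _).trans h⟩,
        fun h => (hcop k).mul_dvd h.1 h.2⟩
  have heta : ∀ h : A ∈ phiGroup N r, eta N r ⟨A, h⟩ = 1 ↔ (2 ^ r.1 : ℤ) ∣ A 1 1 - 1 := fun h => by
    rw [← map_one (gamMk r), eta_eq_iff]
    change ((A 1 1 : ℤ) : ZMod (2 ^ r.1)) = PadicInt.toZModPow r.1 1 ↔ _
    rw [map_one, h1]
    push_cast
    rfl
  have h24 : (2 ^ 2 : ℤ) ∣ 2 ^ r.1 := pow_dvd_pow 2 r.2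
  have hdet : A 0 0 * A 1 1 - A 0 1 * A 1 0 = 1 := by
    rw [← Matrix.det_fin_two]; exact A.2
  have hphi : A ∈ phiGroup N r ↔ A ∈ CongruenceSubgroup.Gamma1 (N * 2 ^ 2) ∧
    A ∈ CongruenceSubgroup.Gamma0 (2 ^ r.1) := Subgroup.mem_inf
  rw [hmap]
  constructor
  · intro hA
    rw [CongruenceSubgroup.Gamma1_mem, h1, h1, h0, hdiv, hdiv, hdiv] at hA
    have hp : A ∈ phiGroup N r := by
      rw [hphi, CongruenceSubgroup.Gamma1_mem, CongruenceSubgroup.Gamma0_mem, h1, h1, h0, h0, hdiv,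
        hdiv, hdiv]
      push_cast
      exact ⟨⟨⟨hA.1.1, h24.trans hA.1.2⟩, ⟨hA.2.1.1, h24.trans hA.2.1.2⟩,
        ⟨hA.2.2.1, h24.trans hA.2.2.2⟩⟩, hA.2.2.2⟩
    exact ⟨hp, (heta hp).2 hA.2.1.2⟩
  · rintro ⟨hp, he⟩
    rw [heta] at he
    rw [hphi, CongruenceSubgroup.Gamma1_mem, CongruenceSubgroup.Gamma0_mem, h1, h1, h0, h0, hdiv,
      hdiv, hdiv] at hp
    push_cast at hp
    rw [CongruenceSubgroup.Gamma1_mem, h1, h1, h0, hdiv, hdiv, hdiv]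
    refine ⟨⟨hp.1.1.1, ?_⟩, ⟨hp.1.2.1.1, he⟩, ⟨hp.1.2.2.1, hp.2⟩⟩
    have : A 0 0 - 1 = -A 0 0 * (A 1 1 - 1) + A 0 1 * A 1 0 := by linear_combination hdet
    rw [this]
    exact dvd_add (he.mul_left _) (hp.2.mul_left _)

theorem phi_conj_mem (N : ℕ) [Fact (Nat.Coprime 2 N)] (r : Level) (α : phiGroup N r)
    (x : GL (Fin 2) ℚ) (hx : x ∈ levelGroup N r) :
    Matrix.SpecialLinearGroup.mapGL ℚ α.1 * x * (Matrix.SpecialLinearGroup.mapGL ℚ α.1)⁻¹ ∈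
      levelGroup N r := by
  obtain ⟨A, -, rfl⟩ := id hx
  obtain ⟨h, he⟩ := (mem_levelGroup_iff N r A).1 hx
  have key : ∀ β : phiGroup N r, eta N r β = 1 → eta N r (α * β * α⁻¹) = 1 := fun β hβ => by
    rw [map_mul, map_mul, hβ, mul_one, ← map_mul, mul_inv_cancel, map_one]
  have h2 : Matrix.SpecialLinearGroup.mapGL ℚ (α * ⟨A, h⟩ * α⁻¹ : phiGroup N r).1 ∈
      levelGroup N r := (mem_levelGroup_iff N r _).2 ⟨_, key ⟨A, h⟩ he⟩
  rwa [Subgroup.coe_mul, Subgroup.coe_mul, Subgroup.coe_inv, map_mul, map_mul, map_inv] at h2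

theorem phi_mem_normalizer (N : ℕ) [Fact (Nat.Coprime 2 N)] (r : Level) (α : phiGroup N r) :
    Matrix.SpecialLinearGroup.mapGL ℚ α.1 ∈
      Subgroup.normalizer (levelGroup N r : Set (GL (Fin 2) ℚ)) := by
  refine Subgroup.mem_normalizer_iff.2 fun x => ⟨phi_conj_mem N r α x, fun h => ?_⟩
  have := phi_conj_mem N r α⁻¹ _ h
  rw [Subgroup.coe_inv, map_inv] at this
  simpa [mul_assoc] using this

/-- `Φ_r` acts on its normal subgroup `Γ₁(N2^r)` by conjugation. -/
def phiConj (N : ℕ) [Fact (Nat.Coprime 2 N)] (r : Level) :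
    phiGroup N r →* MulAut (levelGroup N r) :=
  (levelGroup N r).normalizerMonoidHom.comp
    (((Matrix.SpecialLinearGroup.mapGL ℚ).comp (phiGroup N r).subtype).codRestrict
      (Subgroup.normalizer (levelGroup N r : Set (GL (Fin 2) ℚ))) fun α =>
        (phi_mem_normalizer N r α))

/-- The action of automorphisms of `G` on `Gᵃᵇ`. -/
def abMulAut (G : Type*) [Group G] : MulAut G →* MulAut (Abelianization G) where
  toFun e := MulEquiv.abelianizationCongr e
  map_one' := by ext x; induction x using QuotientGroup.induction_on; rfl
  map_mul' e f := by ext x; induction x using QuotientGroup.induction_on; rfl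

theorem phi_ker (N : ℕ) [Fact (Nat.Coprime 2 N)] (r : Level) (α : phiGroup N r)
    (hα : eta N r α = 1) : abMulAut (levelGroup N r) (phiConj N r α) = 1 := by
  have hmem : Matrix.SpecialLinearGroup.mapGL ℚ α.1 ∈ levelGroup N r :=
    (mem_levelGroup_iff N r α.1).2 ⟨α.2, hα⟩
  refine MulEquiv.ext fun x => ?_
  induction x using QuotientGroup.induction_on with
  | H x =>
    have hx : phiConj N r α x = ⟨_, hmem⟩ * x * ⟨_, hmem⟩⁻¹ := rfl
    change Abelianization.of (phiConj N r α x) = Abelianization.of x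
    rw [hx, map_mul, map_mul, map_inv, mul_comm, inv_mul_cancel_left]

/-- `Γ₁(N2^r)ᵃᵇ`. -/
def LevelAb (N : ℕ) (r : Level) : Type := Abelianization (levelGroup N r)

instance (N : ℕ) (r : Level) : CommGroup (LevelAb N r) :=
  Abelianization.commGroup (levelGroup N r)

/-- The action of `Γ/Γ_r` on `Γ₁(N2^r)ᵃᵇ`: the class `η_r(α)` acts through conjugation
by `α ∈ Φ_r`. -/
def nebentypus (N : ℕ) [Fact (Nat.Coprime 2 N)] (r : Level) :
    GamQuot r →* MulAut (LevelAb N r) :=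
  MonoidHom.liftOfSurjective (eta N r) (fun x => (eta_surjective N r x).imp fun _ h => h.1)
    ⟨(abMulAut (levelGroup N r)).comp (phiConj N r), fun α hα => phi_ker N r α hα⟩

theorem nebentypus_eta (N : ℕ) [Fact (Nat.Coprime 2 N)] (r : Level) (α : phiGroup N r) :
    nebentypus N r (eta N r α) = abMulAut (levelGroup N r) (phiConj N r α) :=
  MonoidHom.liftOfRightInverse_comp_apply _ _ _ _ _

theorem nebentypus_eta_of (N : ℕ) [Fact (Nat.Coprime 2 N)] (r : Level) (α : phiGroup N r)
    (x : levelGroup N r) : nebentypus N r (eta N r α) (Abelianization.of x) =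
      (Abelianization.of (phiConj N r α x) : Abelianization (levelGroup N r)) := by
  rw [nebentypus_eta]; rfl

/-- The matrix `t = (1 0; 0 2)`. -/
def tMat : GL (Fin 2) ℚ :=
  Matrix.GeneralLinearGroup.mkOfDetNeZero !![1, 0; 0, 2] (by simp)

instance (N r : ℕ) [Fact (Nat.Coprime 2 N)] :
    (heckeSubgroup (levelGroup N r) (levelGroup N r) tMat).FiniteIndex := by
  have hN : N ≠ 0 := by
    rintro rfl
    exact absurd (Fact.out : Nat.Coprime 2 0) (by decide)
  have : NeZero (N * 2 ^ r) := ⟨mul_ne_zero hN (pow_ne_zero _ two_ne_zero)⟩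
  obtain ⟨K, hK, hconj⟩ := CongruenceSubgroup.exists_Gamma_le_conj tMat (N * 2 ^ r)
  have : NeZero K := ⟨hK⟩
  have hle : (CongruenceSubgroup.Gamma K).map (Matrix.SpecialLinearGroup.mapGL ℚ) ≤
      (levelGroup N r).comap (MulAut.conj tMat).toMonoidHom := by
    rintro _ ⟨A, hA, rfl⟩
    obtain ⟨B, hB, hB'⟩ := hconj A hA
    refine ⟨B, ?_, hB'⟩
    obtain ⟨h1, -, h3, h4⟩ := CongruenceSubgroup.Gamma_mem.1 hB
    exact (CongruenceSubgroup.Gamma1_mem _ _).2 ⟨h1, h4, h3⟩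
  have hfin : ((CongruenceSubgroup.Gamma K).map (Matrix.SpecialLinearGroup.mapGL ℚ)).relIndex
      (levelGroup N r) ≠ 0 := by
    rw [levelGroup, Subgroup.relIndex_map_map_of_injective _ _
      Matrix.SpecialLinearGroup.mapGL_injective]
    exact (inferInstance : ((CongruenceSubgroup.Gamma K).subgroupOf
      (CongruenceSubgroup.Gamma1 (N * 2 ^ r))).FiniteIndex).index_ne_zero
  exact ⟨fun h0 => hfin (Nat.eq_zero_of_zero_dvd
    ((h0 : Subgroup.relIndex _ _ = 0) ▸ Subgroup.relIndex_dvd_of_le_left _ hle))⟩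

/-- The Atkin operator `U` on `Γ₁(N2^r)ᵃᵇ`. -/
def atkinU (N : ℕ) [Fact (Nat.Coprime 2 N)] (r : Level) :
    LevelAb N r →* LevelAb N r :=
  heckeOperator (levelGroup N r) (levelGroup N r) tMat

theorem atkinU_of (N : ℕ) [Fact (Nat.Coprime 2 N)] (r : Level) (x : levelGroup N r) :
    atkinU N r (Abelianization.of x) = Abelianization.map (heckeConj _ _ tMat)
      (MonoidHom.transfer (Abelianization.of :
        heckeSubgroup (levelGroup N r) (levelGroup N r) tMat →* _) x) := rfl

theorem exists_tMat_conj {N r : ℕ} (α : phiGroup N r) (hα : 2 ∣ α.1 0 1) :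
    ∃ β : phiGroup N r, eta N r β = eta N r α ∧
      tMat * Matrix.SpecialLinearGroup.mapGL ℚ α.1 =
        Matrix.SpecialLinearGroup.mapGL ℚ β.1 * tMat := by
  obtain ⟨b, hb⟩ := hα
  obtain ⟨h1, h2⟩ := Subgroup.mem_inf.1 α.2
  rw [CongruenceSubgroup.Gamma1_mem] at h1
  rw [CongruenceSubgroup.Gamma0_mem] at h2
  have hdet : α.1 0 0 * α.1 1 1 - α.1 0 1 * α.1 1 0 = 1 := by
    rw [← Matrix.det_fin_two]; exact α.1.2
  have hdet' : (!![α.1 0 0, b; 2 * α.1 1 0, α.1 1 1] : Matrix (Fin 2) (Fin 2) ℤ).det = 1 := by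
    rw [Matrix.det_fin_two_of]; rw [hb] at hdet; linear_combination hdet
  let B : SL(2, ℤ) := ⟨!![α.1 0 0, b; 2 * α.1 1 0, α.1 1 1], hdet'⟩
  have hB1 : B ∈ CongruenceSubgroup.Gamma1 (N * 2 ^ 2) := by
    refine (CongruenceSubgroup.Gamma1_mem _ _).2 ⟨h1.1, h1.2.1, ?_⟩
    change ((2 * α.1 1 0 : ℤ) : ZMod (N * 2 ^ 2)) = 0
    rw [Int.cast_mul, h1.2.2, mul_zero]
  have hB0 : B ∈ CongruenceSubgroup.Gamma0 (2 ^ r) := by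
    refine CongruenceSubgroup.Gamma0_mem.2 ?_
    change ((2 * α.1 1 0 : ℤ) : ZMod (2 ^ r)) = 0
    rw [Int.cast_mul, h2, mul_zero]
  refine ⟨⟨B, Subgroup.mem_inf.2 ⟨hB1, hB0⟩⟩, rfl, ?_⟩
  refine Units.ext (Matrix.ext fun i j => ?_)
  have hb' : ((α.1 0 1 : ℤ) : ℚ) = 2 * b := by rw [hb]; push_cast; rfl
  rw [Units.val_mul, Units.val_mul, Matrix.mul_apply, Matrix.mul_apply, Fin.sum_univ_two,
    Fin.sum_univ_two]
  fin_cases i <;> fin_cases j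
  · change (1 : ℚ) * (α.1 0 0 : ℤ) + 0 * (α.1 1 0 : ℤ) = (α.1 0 0 : ℤ) * 1 + (b : ℤ) * 0
    ring
  · change (1 : ℚ) * (α.1 0 1 : ℤ) + 0 * (α.1 1 1 : ℤ) = (α.1 0 0 : ℤ) * 0 + (b : ℤ) * 2
    rw [hb']; ring
  · change (0 : ℚ) * (α.1 0 0 : ℤ) + 2 * (α.1 1 0 : ℤ) =
      ((2 * α.1 1 0 : ℤ) : ℚ) * 1 + (α.1 1 1 : ℤ) * 0
    push_cast; ring
  · change (0 : ℚ) * (α.1 0 1 : ℤ) + 2 * (α.1 1 1 : ℤ) =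
      ((2 * α.1 1 0 : ℤ) : ℚ) * 0 + (α.1 1 1 : ℤ) * 2
    ring

theorem atkinU_nebentypus (N : ℕ) [Fact (Nat.Coprime 2 N)] (r : Level) (g : GamQuot r)
    (x : LevelAb N r) :
    atkinU N r (nebentypus N r g x) = nebentypus N r g (atkinU N r x) := by
  obtain ⟨α, rfl, hα⟩ := eta_surjective N r g
  obtain ⟨β, hβ, hαβ⟩ := exists_tMat_conj α hα
  set K := heckeSubgroup (levelGroup N r) (levelGroup N r) tMat with hK
  set e : levelGroup N r ≃* levelGroup N r := phiConj N r α with he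
  have hconj : ∀ x : GL (Fin 2) ℚ, tMat * (Matrix.SpecialLinearGroup.mapGL ℚ α.1 * x *
      (Matrix.SpecialLinearGroup.mapGL ℚ α.1)⁻¹) * tMat⁻¹ =
      Matrix.SpecialLinearGroup.mapGL ℚ β.1 * (tMat * x * tMat⁻¹) *
        (Matrix.SpecialLinearGroup.mapGL ℚ β.1)⁻¹ := fun x => by
    have h' : Matrix.SpecialLinearGroup.mapGL ℚ β.1 =
      tMat * Matrix.SpecialLinearGroup.mapGL ℚ α.1 * tMat⁻¹ := by rw [hαβ, mul_inv_cancel_right]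
    rw [h']; group
  have hmem : ∀ y : levelGroup N r, y ∈ K ↔ tMat * (y : GL (Fin 2) ℚ) * tMat⁻¹ ∈ levelGroup N r :=
    fun y => Iff.rfl
  have hiff : ∀ y : levelGroup N r, e y ∈ K ↔ y ∈ K := fun y => by
    rw [hmem, hmem]
    change tMat * (Matrix.SpecialLinearGroup.mapGL ℚ α.1 * y *
      (Matrix.SpecialLinearGroup.mapGL ℚ α.1)⁻¹) * tMat⁻¹ ∈ _ ↔ _
    rw [hconj]
    exact (Subgroup.mem_normalizer_iff.1 (phi_mem_normalizer N r β) _).symm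
  let eK : K →* K := (e.toMonoidHom.comp K.subtype).codRestrict K fun k => (hiff k.1).2 k.2
  induction x using QuotientGroup.induction_on with
  | H y =>
    have h1 : nebentypus N r (eta N r α) (Abelianization.of y : Abelianization (levelGroup N r)) =
      (Abelianization.of (e y) : Abelianization (levelGroup N r)) := nebentypus_eta_of N r α y
    change atkinU N r (nebentypus N r (eta N r α)
      (Abelianization.of y : Abelianization (levelGroup N r))) = nebentypus N r (eta N r α)
        (atkinU N r (Abelianization.of y : Abelianization (levelGroup N r)))
    rw [h1]
    have h2 := transfer_conj K (Abelianization.of : K →* Abelianization K) e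
      (fun g hg => (hiff g).2 hg) (fun g hg => (hiff g).1 hg) (Abelianization.map eK)
      (fun k => rfl) y
    refine (atkinU_of N r (e y)).trans ((congrArg _ h2).trans ?_)
    refine Eq.trans ?_ (congrArg (nebentypus N r (eta N r α)) (atkinU_of N r y).symm)
    generalize MonoidHom.transfer (Abelianization.of : K →* Abelianization K) y = z
    induction z using QuotientGroup.induction_on with
    | H k =>
      rw [← hβ]
      refine Eq.trans ?_ (nebentypus_eta_of N r β (heckeConj _ _ tMat k)).symm
      exact congrArg (Abelianization.of : levelGroup N r →* _) (Subtype.ext (hconj k.1))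

/-- The map `Γ₁(N2^r)ᵃᵇ → Γ₁(N2^s)ᵃᵇ` induced by the inclusion. -/
def levelMap (N : ℕ) {r s : Level} (h : s.1 ≤ r.1) :
    LevelAb N r →* LevelAb N s :=
  Abelianization.map (Subgroup.inclusion (levelGroup_anti N h))

theorem levelMap_nebentypus (N : ℕ) [Fact (Nat.Coprime 2 N)] {r s : Level} (h : s.1 ≤ r.1)
    (g : GamQuot r) (x : LevelAb N r) :
    levelMap N h (nebentypus N r g x) = nebentypus N s (gamProj h g) (levelMap N h x) := by
  obtain ⟨α, rfl, -⟩ := eta_surjective N r g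
  let β : phiGroup N s := ⟨α.1, α.2.1, by
    have h0 := CongruenceSubgroup.Gamma0_mem.1 α.2.2
    refine CongruenceSubgroup.Gamma0_mem.2 ?_
    rw [ZMod.intCast_zmod_eq_zero_iff_dvd] at h0 ⊢
    exact (Int.natCast_dvd_natCast.2 (pow_dvd_pow 2 h)).trans h0⟩
  have hβ : gamProj h (eta N r α) = eta N s β := rfl
  rw [hβ]
  induction x using QuotientGroup.induction_on with
  | H y =>
    refine (congrArg (levelMap N h) (nebentypus_eta_of N r α y)).trans ?_
    exact (nebentypus_eta_of N s β (Subgroup.inclusion (levelGroup_anti N h) y)).symm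

/-! ### The modules -/

/-- `A ⊗ ℤ₂`, for a multiplicative abelian group `A`. -/
abbrev TensorAb (A : Type*) [CommGroup A] : Type _ := ℤ_[2] ⊗[ℤ] Additive A

section TensorAb

variable {A B C : Type*} [CommGroup A] [CommGroup B] [CommGroup C]

/-- The `ℤ₂`-linear extension of a homomorphism of abelian groups. -/
def extend (f : A →* B) : TensorAb A →ₗ[ℤ_[2]] TensorAb B :=
  (MonoidHom.toAdditive f).toIntLinearMap.baseChange ℤ_[2]

theorem extend_tmul (f : A →* B) (c : ℤ_[2]) (a : A) :
    extend f (c ⊗ₜ[ℤ] Additive.ofMul a) = c ⊗ₜ[ℤ] Additive.ofMul (f a) := rfl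

theorem extend_ext {f g : TensorAb A →ₗ[ℤ_[2]] TensorAb B}
    (h : ∀ (c : ℤ_[2]) (a : A), f (c ⊗ₜ[ℤ] Additive.ofMul a) = g (c ⊗ₜ[ℤ] Additive.ofMul a)) :
    f = g := by
  refine LinearMap.ext fun x => ?_
  induction x using TensorProduct.induction_on with
  | zero => rw [map_zero, map_zero]
  | tmul c a => exact h c (Additive.toMul a)
  | add x y hx hy => rw [map_add, map_add, hx, hy]

theorem extend_id : extend (MonoidHom.id A) = LinearMap.id :=
  extend_ext fun c a => by rw [extend_tmul]; rfl

theorem extend_comp (f : B →* C) (g : A →* B) : extend (f.comp g) = extend f ∘ₗ extend g :=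
  extend_ext fun c a => by
    rw [LinearMap.comp_apply, extend_tmul, extend_tmul, extend_tmul, MonoidHom.comp_apply]

end TensorAb

/-- `Γ₁(N2^r)ᵃᵇ ⊗ ℤ₂`. -/
def Homology (N : ℕ) (r : Level) : Type := TensorAb (LevelAb N r)

instance (N : ℕ) (r : Level) : AddCommGroup (Homology N r) :=
  TensorProduct.addCommGroup (R := ℤ) (M := ℤ_[2]) (N := Additive (LevelAb N r))

instance (N : ℕ) (r : Level) : Module ℤ_[2] (Homology N r) :=
  TensorProduct.leftModule (R := ℤ) (M := ℤ_[2]) (N := Additive (LevelAb N r))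

/-- The operator `U` on `Γ₁(N2^r)ᵃᵇ ⊗ ℤ₂`. -/
def opU (N : ℕ) [Fact (Nat.Coprime 2 N)] (r : Level) : Module.End ℤ_[2] (Homology N r) :=
  extend (atkinU N r)

/-- The action of `Γ/Γ_r` on `Γ₁(N2^r)ᵃᵇ ⊗ ℤ₂`. -/
def homologyRep (N : ℕ) [Fact (Nat.Coprime 2 N)] (r : Level) :
    Representation ℤ_[2] (GamQuot r) (Homology N r) where
  toFun g := extend (nebentypus N r g).toMonoidHom
  map_one' := (congrArg extend (congrArg MulEquiv.toMonoidHom (map_one (nebentypus N r)))).trans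
    extend_id
  map_mul' g h :=
    (congrArg extend (congrArg MulEquiv.toMonoidHom (map_mul (nebentypus N r) g h))).trans
      (extend_comp (nebentypus N r g).toMonoidHom (nebentypus N r h).toMonoidHom)

/-- The action of `Λ` on `Γ₁(N2^r)ᵃᵇ ⊗ ℤ₂`, through `ℤ₂[Γ/Γ_r]`. -/
def iwasawaAction (N : ℕ) [Fact (Nat.Coprime 2 N)] (r : Level) :
    Iwasawa →ₐ[ℤ_[2]] Module.End ℤ_[2] (Homology N r) :=
  (homologyRep N r).asAlgebraHom.comp (iwasawaProj r)

instance (N : ℕ) [Fact (Nat.Coprime 2 N)] (r : Level) : Module Iwasawa (Homology N r) :=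
  Module.compHom (Homology N r) (iwasawaAction N r).toRingHom

instance (N : ℕ) [Fact (Nat.Coprime 2 N)] (r : Level) :
    IsScalarTower ℤ_[2] Iwasawa (Homology N r) :=
  ⟨fun c a x => by
    change iwasawaAction N r (c • a) x = c • iwasawaAction N r a x
    rw [map_smul, LinearMap.smul_apply]⟩

/-- The transition map `Γ₁(N2^r)ᵃᵇ ⊗ ℤ₂ → Γ₁(N2^s)ᵃᵇ ⊗ ℤ₂` for `s ≤ r`. -/
def transition (N : ℕ) {r s : Level} (h : s.1 ≤ r.1) : Homology N r →ₗ[ℤ_[2]] Homology N s :=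
  extend (levelMap N h)

theorem asAlgebraHom_commute {k G G' V V' : Type*} [CommRing k] [Monoid G] [Monoid G']
    [AddCommGroup V] [Module k V] [AddCommGroup V'] [Module k V'] (φ : G →* G')
    (ρ : Representation k G V) (ρ' : Representation k G' V') (f : V →ₗ[k] V')
    (h : ∀ g x, f (ρ g x) = ρ' (φ g) (f x)) (a : MonoidAlgebra k G) (x : V) :
    f (ρ.asAlgebraHom a x) =
      ρ'.asAlgebraHom (MonoidAlgebra.mapDomainAlgHom k k φ a) (f x) := by
  induction a using MonoidAlgebra.induction_on with
  | of g => simp [h]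
  | add a b ha hb => simp only [map_add, LinearMap.add_apply, ha, hb]
  | smul c a ha => simp only [map_smul, LinearMap.smul_apply, ha]

theorem opU_smul (N : ℕ) [Fact (Nat.Coprime 2 N)] (r : Level) (a : Iwasawa) (x : Homology N r) :
    opU N r (a • x) = a • opU N r x := by
  have h := asAlgebraHom_commute (MonoidHom.id (GamQuot r)) (homologyRep N r) (homologyRep N r)
    (opU N r) (fun g x => by
      change (opU N r * homologyRep N r g) x = (homologyRep N r g * opU N r) x
      refine LinearMap.congr_fun ?_ x
      exact (extend_comp _ _).symm.trans ((congrArg extend (MonoidHom.ext fun y =>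
        atkinU_nebentypus N r g y)).trans (extend_comp _ _))) (iwasawaProj r a) x
  rwa [MonoidAlgebra.mapDomainAlgHom_id] at h

theorem transition_smul (N : ℕ) [Fact (Nat.Coprime 2 N)] {r s : Level} (h : s.1 ≤ r.1)
    (a : Iwasawa) (x : Homology N r) : transition N h (a • x) = a • transition N h x := by
  have h1 := asAlgebraHom_commute (gamProj h) (homologyRep N r) (homologyRep N s)
    (transition N h) (fun g x => by
      change (transition N h ∘ₗ homologyRep N r g) x =
        (homologyRep N s (gamProj h g) ∘ₗ transition N h) x
      refine LinearMap.congr_fun ?_ x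
      exact (extend_comp _ _).symm.trans ((congrArg extend (MonoidHom.ext fun y =>
        levelMap_nebentypus N h g y)).trans (extend_comp _ _))) (iwasawaProj r a) x
  have h2 : MonoidAlgebra.mapDomainAlgHom ℤ_[2] ℤ_[2] (gamProj h) (iwasawaProj r a) =
    iwasawaProj s a := a.2 r s h
  rw [h2] at h1
  exact h1

/-- The ordinary part `(Γ₁(N2^r)ᵃᵇ ⊗ ℤ₂)ᵒʳᵈ`, a `Λ`-module. -/
def OrdHomology (N : ℕ) [Fact (Nat.Coprime 2 N)] (r : Level) : Submodule Iwasawa (Homology N r) :=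
  { ordinaryPart (opU N r) with
    smul_mem' := fun a x hx => by
      refine map_mem_ordinaryPart (iwasawaAction N r a) (fun y => ?_) hx
      exact (opU_smul N r a y).symm }

/-- The Iwasawa module `W`, the inverse limit over `r ≥ 2` of the modules `Γ₁(N2^r)ᵃᵇ ⊗ ℤ₂`. -/
def Limit (N : ℕ) [Fact (Nat.Coprime 2 N)] : Submodule Iwasawa ((r : Level) → Homology N r) where
  carrier := {w | ∀ (r s : Level) (h : s.1 ≤ r.1), transition N h (w r) = w s}
  zero_mem' := fun r s h => map_zero _
  add_mem' := fun {a b} ha hb r s h => by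
    rw [Pi.add_apply, map_add, ha r s h, hb r s h, Pi.add_apply]
  smul_mem' := fun c a ha r s h => by
    rw [Pi.smul_apply, transition_smul, ha r s h, Pi.smul_apply]

/-- `Wᵒʳᵈ`, the inverse limit over `r ≥ 2` of the modules `(Γ₁(N2^r)ᵃᵇ ⊗ ℤ₂)ᵒʳᵈ`: it consists of the
compatible systems of ordinary elements. -/
def OrdLimit (N : ℕ) [Fact (Nat.Coprime 2 N)] : Submodule Iwasawa ((r : Level) → Homology N r) :=
  Limit N ⊓ Submodule.pi Set.univ fun r => OrdHomology N r

/-- The action of `Γ_r` on a `Λ`-module, as a representation over `ℤ₂`. -/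
def gamRep (r : Level) (V : Type*) [AddCommGroup V] [Module ℤ_[2] V] [Module Iwasawa V]
    [IsScalarTower ℤ_[2] Iwasawa V] : Representation ℤ_[2] (gamSub r) V :=
  ((Algebra.lsmul ℤ_[2] ℤ_[2] V : Iwasawa →ₐ[ℤ_[2]] Module.End ℤ_[2] V) :
    Iwasawa →* Module.End ℤ_[2] V).comp (iwasawaOf.comp (gamSub r).subtype)

end TwoAdicControl

end

/-! Put n = N·2^s and pass from level n to level 2n through the intermediate group H = Γ₁(n) ∩
Γ₀(2n), so that Γ₁(2n) ⊂ H ⊂ Γ₁(n).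

Conjugation by t doubles the lower left entry, so `U` on Γ₁(n)ᵃᵇ factors through a map V : Γ₁(n)ᵃᵇ →
Hᵃᵇ. The composites of V with Hᵃᵇ → Γ₁(n)ᵃᵇ in both orders are the operators `U`
(`exists_tensorIncl_midGamma_eq_tensorU`). Since `U` is invertible on ordinary parts, H and Γ₁(n)
have the same ordinary part.

The group Γ₁(2n) is normal in H with cyclic quotient of order 2. If σ generates the quotient, the
kernel of Γ₁(2n)ᵃᵇ → Hᵃᵇ is the image of σ - 1 (`exists_eq_conj_div_of_map_eq_one`). The cokernel
has order 2 and does not vanish after tensoring with ℤ₂; but `U` acts on it as a transfer of index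
2, hence by squaring, hence trivially (`heckeOperator_midGamma_mem_range`). Ordinary elements are
values of `U`, so the map is surjective on ordinary parts.

Let γ lie in Γ_s but not in Γ_{s+1}. One step up the tower the transition map is therefore
surjective on ordinary parts with kernel (γ - 1). The square γ² stands in the same relation to level
s + 1, and γ² - 1 = (γ - 1)(γ + 1), so induction gives the kernel (γ - 1) for every transition map
down to level s (`exists_smul_sub_eq`).

In the limit, surjectivity follows by successive lifting. The equation (γ - 1)x = w has solutions at
every level, and compactness of finitely generated ℤ₂-modules makes them compatible
(`exists_compatible_preimage`). Thus an element of 𝐖ᵒʳᵈ that vanishes at level r has the form γx - x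
with γ in Γ_r (`exists_mem_gamSub_eq_smul_sub`), which gives both descriptions of the quotient. -/

noncomputable section

namespace TwoAdicControl

/-! ### Splitting a finite module into ordinary and topologically nilpotent parts -/

section OrdinaryDecomposition

variable {M M' : Type*} [AddCommGroup M] [Module ℤ_[2] M] [AddCommGroup M'] [Module ℤ_[2] M']

/-- The submodule of the `m` with `Uⁿ m → 0` in the `2`-adic topology. -/
def topNilpotentPart (U : Module.End ℤ_[2] M) : Submodule ℤ_[2] M where
  carrier := {m | ∀ k : ℕ, ∃ n : ℕ, ∃ y, (U ^ n) m = (2 ^ k : ℤ_[2]) • y}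
  zero_mem' := fun k => ⟨0, 0, by simp⟩
  add_mem' := fun {a b} ha hb k => by
    obtain ⟨n, y, hy⟩ := ha k
    obtain ⟨m, z, hz⟩ := hb k
    refine ⟨m + n, (U ^ m) y + (U ^ n) z, ?_⟩
    rw [map_add, pow_add, Module.End.mul_apply, hy, ← pow_add, add_comm m n, pow_add,
      Module.End.mul_apply, hz, map_smul, map_smul, smul_add]
  smul_mem' := fun c m hm k => by
    obtain ⟨n, y, hy⟩ := hm k
    exact ⟨n, c • y, by rw [map_smul, hy, smul_comm]⟩

theorem map_mem_topNilpotentPart {U : Module.End ℤ_[2] M} {U' : Module.End ℤ_[2] M'}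
    (f : M →ₗ[ℤ_[2]] M') (hf : ∀ x, f (U x) = U' (f x)) {m : M} (hm : m ∈ topNilpotentPart U) :
    f m ∈ topNilpotentPart U' := by
  intro k
  obtain ⟨n, y, hy⟩ := hm k
  refine ⟨n, f y, ?_⟩
  have hn : ∀ (n : ℕ) x, f ((U ^ n) x) = (U' ^ n) (f x) := by
    intro n
    induction n with
    | zero => simp
    | succ n ih =>
      intro x
      rw [pow_succ, pow_succ, Module.End.mul_apply, ih, hf, Module.End.mul_apply]
  rw [← hn, hy, map_smul]

theorem eq_zero_of_forall_two_pow_smul [Module.Finite ℤ_[2] M] {m : M}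
    (h : ∀ k : ℕ, ∃ y, m = (2 ^ k : ℤ_[2]) • y) : m = 0 := by
  have := (isAdicComplete_of_finite M).toIsHausdorff
  refine this.haus m fun n => ?_
  obtain ⟨y, rfl⟩ := h n
  rw [SModEq.zero, PadicInt.maximalIdeal_eq_span_p, Ideal.span_singleton_pow]
  exact Submodule.smul_mem_smul (Ideal.mem_span_singleton_self _) trivial

theorem commute_aeval (U : Module.End ℤ_[2] M) (Q : Polynomial ℤ_[2]) :
    Commute (Polynomial.aeval U Q) U := by
  have h : Polynomial.aeval U (Q * Polynomial.X) = Polynomial.aeval U (Polynomial.X * Q) := by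
    rw [mul_comm]
  rwa [map_mul, map_mul, Polynomial.aeval_X] at h

/-- A polynomial in `U` inverts `U` at an ordinary element, so `U` is injective on the ordinary
part; the next lemma is the surjectivity. -/
theorem eq_zero_of_mem_ordinaryPart_of_apply_eq_zero {U : Module.End ℤ_[2] M} {m : M}
    (h : m ∈ ordinaryPart U) (h0 : U m = 0) : m = 0 := by
  obtain ⟨Q, hQ⟩ := (mem_ordinaryPart_iff U m).1 h
  have hc := (commute_aeval U Q).symm
  rw [← hQ, ← Module.End.mul_apply, hc.eq, Module.End.mul_apply, h0, map_zero]

theorem exists_ordinary_apply_eq {U : Module.End ℤ_[2] M} {m : M} (h : m ∈ ordinaryPart U) :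
    ∃ x ∈ ordinaryPart U, U x = m := by
  obtain ⟨Q, hQ⟩ := (mem_ordinaryPart_iff U m).1 h
  exact ⟨_, map_mem_ordinaryPart (Polynomial.aeval U Q)
    (fun x => LinearMap.congr_fun (commute_aeval U Q).eq x) h, hQ⟩

/-- If q is a polynomial in `U` with U q m = m, then qⁿUⁿm = m for all n. As Uⁿm can be made
divisible by any power of 2, so is m. -/
theorem eq_zero_of_mem_ordinaryPart_of_mem_topNilpotentPart [Module.Finite ℤ_[2] M]
    {U : Module.End ℤ_[2] M} {m : M} (h : m ∈ ordinaryPart U) (h' : m ∈ topNilpotentPart U) :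
    m = 0 := by
  obtain ⟨Q, hQ⟩ := (mem_ordinaryPart_iff U m).1 h
  set q := Polynomial.aeval U Q
  have hc : Commute q U := commute_aeval U Q
  have hn : ∀ n : ℕ, (q ^ n) ((U ^ n) m) = m := by
    intro n
    induction n with
    | zero => simp
    | succ n ih =>
      rw [← Module.End.mul_apply, ← hc.mul_pow, pow_succ, Module.End.mul_apply, hc.mul_pow,
        Module.End.mul_apply, hc.eq, Module.End.mul_apply, hQ, ih]
  refine eq_zero_of_forall_two_pow_smul fun k => ?_
  obtain ⟨n, y, hy⟩ := h' k
  exact ⟨(q ^ n) y, by rw [← map_smul, ← hy, hn]⟩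

/-- In a finite commutative `ℤ₂`-algebra, some power of `u` is congruent mod `2` to an
idempotent. -/
theorem exists_idempotent_near_pow {A : Type*} [CommRing A] [Algebra ℤ_[2] A]
    [Module.Finite ℤ_[2] A] (u : A) :
    ∃ n ≠ 0, ∃ e b : A, e * e = e ∧ u ^ n = e + 2 * b := by
  set I : Ideal A := (IsLocalRing.maximalIdeal ℤ_[2]).map (algebraMap ℤ_[2] A) with hI
  have hc : IsAdicComplete I A := by
    rw [hI, IsAdicComplete.map_algebraMap_iff]
    exact isAdicComplete_of_finite A
  have hI2 : I = Ideal.span {2} := by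
    rw [hI, PadicInt.maximalIdeal_eq_span_p, Ideal.map_span, Set.image_singleton, map_natCast,
      Nat.cast_ofNat]
  have hfin : Finite (A ⧸ I) := by
    have h1 : Finite (ℤ_[2] ⧸ IsLocalRing.maximalIdeal ℤ_[2]) :=
      Finite.of_equiv _ (PadicInt.residueField (p := 2)).symm.toEquiv
    have h2 : Module.Finite (ℤ_[2] ⧸ IsLocalRing.maximalIdeal ℤ_[2]) (A ⧸ I) :=
      Module.Finite.of_restrictScalars_finite ℤ_[2] _ _
    exact Module.finite_of_finite (ℤ_[2] ⧸ IsLocalRing.maximalIdeal ℤ_[2])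
  -- A/2A is finite, so some power of u is idempotent there; Hensel's lemma for X² - X lifts this
  -- idempotent to A.
  obtain ⟨n, hn, hidem⟩ := exists_pow_idempotent (Ideal.Quotient.mk I u)
  have hb : u ^ n * u ^ n - u ^ n ∈ I := by
    rw [← Ideal.Quotient.eq, map_mul, map_pow]; exact hidem
  have hmon : (Polynomial.X ^ 2 - Polynomial.X : Polynomial A).Monic := by
    rcases subsingleton_or_nontrivial A with h | h
    · exact Polynomial.monic_of_subsingleton _
    · exact Polynomial.monic_X_pow_sub (by rw [Polynomial.degree_X]; norm_num)
  obtain ⟨e, he, hea⟩ := HenselianRing.is_henselian (I := I)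
    (Polynomial.X ^ 2 - Polynomial.X : Polynomial A) hmon (u ^ n)
    (by simpa [pow_two] using hb) (by
      -- The derivative 2a - 1 at a = uⁿ is its own inverse mod I, because (2a - 1)² - 1 = 4(a² -
      -- a).
      refine IsUnit.of_mul_eq_one (Ideal.Quotient.mk I (2 * u ^ n - 1)) ?_
      rw [← map_mul, ← map_one (Ideal.Quotient.mk I), Ideal.Quotient.eq]
      have e1 : Polynomial.eval (u ^ n)
          (Polynomial.derivative (Polynomial.X ^ 2 - Polynomial.X : Polynomial A)) =
            2 * u ^ n - 1 := by
        simp [one_add_one_eq_two]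
      rw [e1]
      have e2 : (2 * u ^ n - 1) * (2 * u ^ n - 1) - 1 = 4 * (u ^ n * u ^ n - u ^ n) := by ring
      rw [e2]
      exact I.mul_mem_left _ hb)
  rw [hI2, Ideal.mem_span_singleton] at hea
  obtain ⟨b, hb⟩ := hea
  refine ⟨n, hn, e, -b, ?_, by linear_combination -hb⟩
  have : e ^ 2 - e = 0 := by simpa [Polynomial.IsRoot] using he
  rw [← pow_two]; exact sub_eq_zero.1 this

/-- Every element is the sum of an ordinary and a topologically nilpotent one. -/
theorem exists_ordinary_add_topNilpotent [Module.Finite ℤ_[2] M] (U : Module.End ℤ_[2] M) (m : M) :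
    ∃ x ∈ ordinaryPart U, ∃ y ∈ topNilpotentPart U, m = x + y := by
  have hA := opAlgebra_finite U
  obtain ⟨n, hn, e, b, he, hu⟩ := exists_idempotent_near_pow (opElem U)
  -- From uⁿ = e + 2b one gets uⁿe = (1 + 2b)e and uⁿ(1 - e) = 2b(1 - e). As 2 is in the Jacobson
  -- radical, 1 + 2b is a unit, so u is invertible on the image of e and topologically nilpotent on
  -- that of 1 - e.
  have hunit : IsUnit (1 + 2 * b : opAlgebra U) := by
    have hc : IsAdicComplete ((IsLocalRing.maximalIdeal ℤ_[2]).map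
        (algebraMap ℤ_[2] (opAlgebra U))) (opAlgebra U) := by
      rw [IsAdicComplete.map_algebraMap_iff]
      exact isAdicComplete_of_finite _
    have h2 : (2 : opAlgebra U) ∈ (IsLocalRing.maximalIdeal ℤ_[2]).map
        (algebraMap ℤ_[2] (opAlgebra U)) := by
      have := Ideal.mem_map_of_mem (algebraMap ℤ_[2] (opAlgebra U))
        (I := IsLocalRing.maximalIdeal ℤ_[2]) (x := 2)
        (by rw [PadicInt.maximalIdeal_eq_span_p]; exact Ideal.mem_span_singleton_self _)
      rwa [map_ofNat] at this
    have := Ideal.mem_jacobson_bot.1 (IsAdicComplete.le_jacobson_bot _ h2) b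
    rwa [add_comm] at this
  obtain ⟨v, hv⟩ := hunit.exists_left_inv
  obtain ⟨l, rfl⟩ := Nat.exists_eq_succ_of_ne_zero hn
  have hpow : ∀ k : ℕ, ((U ^ (l + 1)) ^ k : Module.End ℤ_[2] M) =
      ((opElem U ^ (l + 1)) ^ k : opAlgebra U).1 := fun k => by
    rw [SubmonoidClass.coe_pow, SubmonoidClass.coe_pow]; rfl
  refine ⟨e.1 m, ?_, m - e.1 m, ?_, by abel⟩
  · obtain ⟨Q, hQ⟩ := (v * opElem U ^ l).2
    refine (mem_ordinaryPart_iff U _).2 ⟨Q, ?_⟩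
    have h1 : opElem U * (v * opElem U ^ l) * e = e := by
      have : opElem U * (v * opElem U ^ l) * e = v * (opElem U ^ (l + 1)) * e := by ring
      rw [this, hu]
      linear_combination v * he + e * hv
    have h2 := LinearMap.congr_fun (congrArg Subtype.val h1) m
    have hQ' : (Polynomial.aeval U Q : Module.End ℤ_[2] M) = (v * opElem U ^ l).1 := hQ
    rw [hQ']
    exact h2
  · intro k
    have h1 : ∀ k : ℕ, (opElem U ^ (l + 1)) ^ k * (1 - e) = 2 ^ k * (b ^ k * (1 - e)) := by
      intro k
      induction k with
      | zero => simp
      | succ k ih =>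
        have : opElem U ^ (l + 1) * (1 - e) = 2 * (b * (1 - e)) := by
          rw [hu]; linear_combination -he
        calc (opElem U ^ (l + 1)) ^ (k + 1) * (1 - e)
            = (opElem U ^ (l + 1)) ^ k * (opElem U ^ (l + 1) * (1 - e)) := by ring
          _ = 2 * b * ((opElem U ^ (l + 1)) ^ k * (1 - e)) := by rw [this]; ring
          _ = _ := by rw [ih]; ring
    refine ⟨(l + 1) * k, (b ^ k * (1 - e)).1 m, ?_⟩
    have h2 := LinearMap.congr_fun (congrArg Subtype.val (h1 k)) m
    have h3 : (2 ^ k * (b ^ k * (1 - e)) : opAlgebra U) =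
        (2 ^ k : ℤ_[2]) • (b ^ k * (1 - e)) := by
      rw [Algebra.smul_def, map_pow, map_ofNat]
    rw [pow_mul, hpow]
    rw [h3] at h2
    exact h2

/-- An ordinary element in the image of an equivariant map is the image of an ordinary element. -/
theorem exists_ordinary_preimage [Module.Finite ℤ_[2] M] [Module.Finite ℤ_[2] M']
    {U : Module.End ℤ_[2] M} {U' : Module.End ℤ_[2] M'} (f : M →ₗ[ℤ_[2]] M')
    (hf : ∀ x, f (U x) = U' (f x)) {m : M} (hm : f m ∈ ordinaryPart U') :
    ∃ x ∈ ordinaryPart U, f x = f m := by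
  obtain ⟨x, hx, y, hy, rfl⟩ := exists_ordinary_add_topNilpotent U m
  refine ⟨x, hx, ?_⟩
  -- The image of the topologically nilpotent component is a difference of ordinary elements, so it
  -- lies in both parts and vanishes.
  have h1 : f y ∈ ordinaryPart U' := by
    have := (ordinaryPart U').sub_mem hm (map_mem_ordinaryPart f hf hx)
    rwa [map_add, add_sub_cancel_left] at this
  rw [map_add, eq_zero_of_mem_ordinaryPart_of_mem_topNilpotentPart h1
    (map_mem_topNilpotentPart f hf hy), add_zero]

end OrdinaryDecomposition

/-! ### Compatible solutions of linear equations by compactness -/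

section Compactness

/-- Since ℤ₂ is noetherian, the kernel is the continuous image of some ℤ₂ⁿ, hence compact. No
topology on the target is needed. -/
theorem isClosed_ker_of_finite {E P : Type*} [AddCommGroup E] [Module ℤ_[2] E] [TopologicalSpace E]
    [ContinuousAdd E] [ContinuousSMul ℤ_[2] E] [T2Space E] [Module.Finite ℤ_[2] E]
    [AddCommGroup P] [Module ℤ_[2] P] (f : E →ₗ[ℤ_[2]] P) :
    IsClosed (LinearMap.ker f : Set E) := by
  obtain ⟨n, g, hg⟩ := Module.Finite.exists_fin' ℤ_[2] (LinearMap.ker f)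
  have h1 : (LinearMap.ker f : Set E) = Set.range ((LinearMap.ker f).subtype ∘ₗ g) := by
    rw [← LinearMap.coe_range, LinearMap.range_comp, LinearMap.range_eq_top.2 hg,
      Submodule.map_top, Submodule.range_subtype]
  rw [h1]
  exact (isCompact_range (LinearMap.continuous_on_pi _)).isClosed

theorem isClosed_preimage_singleton {E P : Type*} [AddCommGroup E] [Module ℤ_[2] E]
    [TopologicalSpace E] [IsTopologicalAddGroup E] [ContinuousSMul ℤ_[2] E] [T2Space E]
    [Module.Finite ℤ_[2] E] [AddCommGroup P] [Module ℤ_[2] P] (f : E →ₗ[ℤ_[2]] P) (p : P) :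
    IsClosed (f ⁻¹' {p}) := by
  by_cases h : ∃ x, f x = p
  · obtain ⟨x, rfl⟩ := h
    have : f ⁻¹' {f x} = (fun y => y - x) ⁻¹' (LinearMap.ker f : Set E) := by
      ext y
      simp [sub_eq_zero]
    rw [this]
    exact (isClosed_ker_of_finite f).preimage (by fun_prop)
  · have : f ⁻¹' {p} = ∅ := Set.eq_empty_of_forall_notMem fun y hy => h ⟨y, hy⟩
    rw [this]
    exact isClosed_empty

/-- In an inverse system of finite `ℤ₂`-modules, a compatible system of solvable linear equations
has a compatible system of solutions. -/
theorem exists_compatible_preimage {A B : ℕ → Type*} [∀ n, AddCommGroup (A n)]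
    [∀ n, Module ℤ_[2] (A n)] [∀ n, Module.Finite ℤ_[2] (A n)] [∀ n, AddCommGroup (B n)]
    [∀ n, Module ℤ_[2] (B n)] (a : ∀ n, A (n + 1) →ₗ[ℤ_[2]] A n)
    (b : ∀ n, B (n + 1) →ₗ[ℤ_[2]] B n) (φ : ∀ n, A n →ₗ[ℤ_[2]] B n)
    (hφ : ∀ n x, φ n (a n x) = b n (φ (n + 1) x)) (w : ∀ n, B n) (hw : ∀ n, b n (w (n + 1)) = w n)
    (h : ∀ n, ∃ x, φ n x = w n) :
    ∃ x : ∀ n, A n, (∀ n, a n (x (n + 1)) = x n) ∧ ∀ n, φ n (x n) = w n := by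
  have hfin : ∀ n, ∃ (k : ℕ) (f : (Fin k → ℤ_[2]) →ₗ[ℤ_[2]] A n), Function.Surjective f :=
    fun n => Module.Finite.exists_fin' ℤ_[2] (A n)
  choose k f hf using hfin
  -- The product of the free modules covering the `A n` is compact. `C m` imposes only the
  -- conditions with index below m; these sets decrease and are closed, and a point of their
  -- intersection is a solution.
  let C : ℕ → Set (∀ n, Fin (k n) → ℤ_[2]) := fun m =>
    {c | ∀ n < m, a n (f (n + 1) (c (n + 1))) = f n (c n) ∧ φ n (f n (c n)) = w n}
  have hclosed : ∀ m, IsClosed (C m) := by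
    intro m
    simp only [C, Set.ofPred_forall, Set.ofPred_and]
    refine isClosed_iInter fun n => isClosed_iInter fun _ => IsClosed.inter ?_ ?_
    · have h1 := isClosed_preimage_singleton
        ((a n ∘ₗ f (n + 1)) ∘ₗ LinearMap.fst ℤ_[2] (Fin (k (n + 1)) → ℤ_[2]) (Fin (k n) → ℤ_[2]) -
          f n ∘ₗ LinearMap.snd ℤ_[2] (Fin (k (n + 1)) → ℤ_[2]) (Fin (k n) → ℤ_[2])) 0
      convert h1.preimage (f := fun c : (∀ n, Fin (k n) → ℤ_[2]) => (c (n + 1), c n))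
        (by fun_prop) using 1
      ext c
      simp [sub_eq_zero]
    · exact (isClosed_preimage_singleton (φ n ∘ₗ f n) (w n)).preimage
        (f := fun c : (∀ n, Fin (k n) → ℤ_[2]) => c n) (by fun_prop)
  have hanti : ∀ m, C (m + 1) ⊆ C m := fun m c hc n hn => hc n (hn.trans (Nat.lt_succ_self m))
  have hne : ∀ m, (C m).Nonempty := by
    intro m
    have h1 : ∀ m, ∃ x : ∀ n, A n, (∀ n < m, a n (x (n + 1)) = x n) ∧
        ∀ n < m + 1, φ n (x n) = w n := by
      intro m
      -- A solution at level m is pushed down to all lower levels by the transition maps; the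
      -- coordinates above m are unconstrained and set to 0.
      have h2 : ∀ z : A m, φ m z = w m → ∃ x : ∀ n, A n, x m = z ∧
          (∀ n < m, a n (x (n + 1)) = x n) ∧ ∀ n < m + 1, φ n (x n) = w n := by
        induction m with
        | zero =>
          intro z hz
          classical
          refine ⟨Function.update (fun _ => 0) 0 z, by simp, by simp, fun n hn => ?_⟩
          obtain rfl : n = 0 := by omega
          simpa using hz
        | succ m ih =>
          intro z hz
          obtain ⟨x, hxm, hx1, hx2⟩ := ih (a m z) (by rw [hφ, hz, hw])
          classical
          refine ⟨Function.update x (m + 1) z, by simp, fun n hn => ?_, fun n hn => ?_⟩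
          · by_cases h : n = m
            · subst h
              rw [Function.update_self, Function.update_of_ne (by omega), hxm]
            · rw [Function.update_of_ne (by omega), Function.update_of_ne (by omega)]
              exact hx1 n (by omega)
          · by_cases h : n = m + 1
            · subst h
              rwa [Function.update_self]
            · rw [Function.update_of_ne h]
              exact hx2 n (by omega)
      obtain ⟨z, hz⟩ := h m
      obtain ⟨x, -, hx⟩ := h2 z hz
      exact ⟨x, hx⟩
    obtain ⟨x, hx1, hx2⟩ := h1 m
    choose c hc using fun n => hf n (x n)
    refine ⟨c, fun n hn => ?_⟩
    rw [hc, hc]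
    exact ⟨hx1 n hn, hx2 n (by omega)⟩
  obtain ⟨c, hc⟩ := IsCompact.nonempty_iInter_of_sequence_nonempty_isCompact_isClosed C hanti hne
    (hclosed 0).isCompact hclosed
  rw [Set.mem_iInter] at hc
  exact ⟨fun n => f n (c n), fun n => (hc (n + 1) n (Nat.lt_succ_self n)).1,
    fun n => (hc (n + 1) n (Nat.lt_succ_self n)).2⟩

end Compactness

/-! ### Naturality of the transfer -/

section Transfer

theorem transfer_map {G A B : Type*} [Group G] [CommGroup A] [CommGroup B] (K : Subgroup G)
    [K.FiniteIndex] (ϕ : K →* A) (θ : A →* B) (g : G) :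
    θ (MonoidHom.transfer ϕ g) = MonoidHom.transfer (θ.comp ϕ) g := by
  have S : K.LeftTransversal := default
  rw [MonoidHom.transfer_def ϕ S, MonoidHom.transfer_def (θ.comp ϕ) S,
    Subgroup.leftTransversals.diff, Subgroup.leftTransversals.diff, map_prod]
  rfl

/-- The transfer of a homomorphism defined on the whole group is a power. -/
theorem transfer_restrict {G A : Type*} [Group G] [CommGroup A] (K : Subgroup G) [K.FiniteIndex]
    (χ : G →* A) (g : G) :
    MonoidHom.transfer (χ.comp K.subtype) g = χ g ^ K.index := by
  let _ := K.fintypeQuotientOfFiniteIndex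
  have hσ : ∀ q : G ⧸ K, ((Quotient.out q : G) : G ⧸ K) = q := fun q => Quotient.out_eq' q
  have hmem : ∀ q : G ⧸ K, (Quotient.out q)⁻¹ * (g * Quotient.out (g⁻¹ • q)) ∈ K := fun q => by
    rw [← QuotientGroup.eq, hσ, ← smul_eq_mul, ← MulAction.Quotient.smul_coe, hσ, smul_inv_smul]
  rw [transfer_eq_prod K (χ.comp K.subtype) Quotient.out hσ g hmem]
  -- Each factor is χ(g) times a quotient of values of χ at coset representatives; as g⁻¹ permutes
  -- the cosets, these quotients cancel in the product.
  have h1 : ∀ q : G ⧸ K, (χ.comp K.subtype) ⟨_, hmem q⟩ =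
      χ g * ((χ (Quotient.out q))⁻¹ * χ (Quotient.out (g⁻¹ • q))) := fun q => by
    change χ ((Quotient.out q)⁻¹ * (g * Quotient.out (g⁻¹ • q))) = _
    rw [map_mul, map_mul, map_inv, mul_left_comm]
  rw [Finset.prod_congr rfl fun q _ => h1 q, Finset.prod_mul_distrib, Finset.prod_mul_distrib,
    Finset.prod_inv_distrib, Finset.prod_const, Finset.card_univ, ← Nat.card_eq_fintype_card,
    Subgroup.index_eq_card]
  rw [Fintype.prod_equiv (MulAction.toPerm g⁻¹ : Equiv.Perm (G ⧸ K))
    (fun q => χ (Quotient.out (g⁻¹ • q))) (fun q => χ (Quotient.out q)) fun q => rfl,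
    inv_mul_cancel, mul_one]

/-- The transfer is compatible with a homomorphism that is bijective on cosets. -/
theorem transfer_comp {G H A : Type*} [Group G] [Group H] [CommGroup A] (K : Subgroup G)
    (L : Subgroup H) [K.FiniteIndex] [L.FiniteIndex] (ι : H →* G) (hL : ∀ h, h ∈ L ↔ ι h ∈ K)
    (hs : ∀ g, ∃ h, (ι h)⁻¹ * g ∈ K) (ϕ : K →* A) (ψ : L →* A)
    (hψ : ∀ l : L, ψ l = ϕ ⟨ι l, (hL _).1 l.2⟩) (h : H) :
    MonoidHom.transfer ϕ (ι h) = MonoidHom.transfer ψ h := by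
  let _ := K.fintypeQuotientOfFiniteIndex
  let _ := L.fintypeQuotientOfFiniteIndex
  let e : H ⧸ L → G ⧸ K := Quotient.map' ι fun a b hab => by
    rw [QuotientGroup.leftRel_apply] at hab ⊢
    rw [← map_inv, ← map_mul]; exact (hL _).1 hab
  have he : ∀ x : H, e (x : H ⧸ L) = (ι x : G) := fun x => rfl
  have hbij : Function.Bijective e := by
    constructor
    · intro a b hab
      induction a using QuotientGroup.induction_on with
      | H x =>
        induction b using QuotientGroup.induction_on with
        | H y =>
          rw [he, he, QuotientGroup.eq, ← map_inv, ← map_mul, ← hL] at hab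
          exact QuotientGroup.eq.2 hab
    · intro q
      induction q using QuotientGroup.induction_on with
      | H g =>
        obtain ⟨x, hx⟩ := hs g
        exact ⟨x, by rw [he]; exact QuotientGroup.eq.2 hx⟩
  let E := Equiv.ofBijective e hbij
  have hE : ∀ x : H, E (x : H ⧸ L) = (ι x : G) := fun x => rfl
  have hEs : ∀ (x : H) (q : H ⧸ L), E (x • q) = ι x • E q := fun x q => by
    induction q using QuotientGroup.induction_on with
    | H y => exact congrArg QuotientGroup.mk (map_mul ι x y)
  let σ : H ⧸ L → H := Quotient.out
  have hσ : ∀ q, (σ q : H ⧸ L) = q := fun q => Quotient.out_eq' q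
  -- The transfer does not depend on the representatives, so those of G/K are taken to be the images
  -- of those of H/L.
  let τ : G ⧸ K → G := fun q => ι (σ (E.symm q))
  have hτ : ∀ q, (τ q : G ⧸ K) = q := fun q => by rw [← hE, hσ, E.apply_symm_apply]
  have hm1 : ∀ q, (σ q)⁻¹ * (h * σ (h⁻¹ • q)) ∈ L := fun q => by
    rw [← QuotientGroup.eq, hσ, ← smul_eq_mul, ← MulAction.Quotient.smul_coe, hσ, smul_inv_smul]
  have hm2 : ∀ q, (τ q)⁻¹ * (ι h * τ ((ι h)⁻¹ • q)) ∈ K := fun q => by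
    rw [← QuotientGroup.eq, hτ, ← smul_eq_mul, ← MulAction.Quotient.smul_coe, hτ, smul_inv_smul]
  rw [transfer_eq_prod K ϕ τ hτ _ hm2, transfer_eq_prod L ψ σ hσ _ hm1]
  refine (Fintype.prod_equiv E _ _ fun q => ?_).symm
  rw [hψ]
  refine congrArg ϕ (Subtype.ext ?_)
  change ι ((σ q)⁻¹ * (h * σ (h⁻¹ • q))) = (ι (σ (E.symm (E q))))⁻¹ *
    (ι h * ι (σ (E.symm ((ι h)⁻¹ • E q))))
  rw [← map_inv ι h, ← hEs, E.symm_apply_apply, E.symm_apply_apply, map_mul, map_inv, map_mul]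

end Transfer

/-! ### Hecke operators and inclusions of groups -/

section HeckeFunctoriality

variable {T : Type*} [Group T]

theorem mem_heckeSubgroup {G H : Subgroup T} {t : T} {x : G} :
    x ∈ heckeSubgroup G H t ↔ t * x * t⁻¹ ∈ H := Iff.rfl

theorem heckeOperator_of (G H : Subgroup T) (t : T) [(heckeSubgroup G H t).FiniteIndex] (x : G) :
    heckeOperator G H t (Abelianization.of x) =
      MonoidHom.transfer ((Abelianization.of : H →* _).comp (heckeConj G H t)) x :=
  transfer_map _ _ (Abelianization.map (heckeConj G H t)) x

/-- Hecke operators are compatible with inclusions that are bijective on cosets. -/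
theorem heckeOperator_inclusion {G G' H H' : Subgroup T} (hG : G' ≤ G) (hH : H' ≤ H) (t : T)
    [(heckeSubgroup G H t).FiniteIndex] [(heckeSubgroup G' H' t).FiniteIndex]
    (h1 : ∀ g ∈ G', t * g * t⁻¹ ∈ H → t * g * t⁻¹ ∈ H')
    (h2 : ∀ g ∈ G, ∃ g' ∈ G', t * (g'⁻¹ * g) * t⁻¹ ∈ H) (x : Abelianization G') :
    Abelianization.map (Subgroup.inclusion hH) (heckeOperator G' H' t x) =
      heckeOperator G H t (Abelianization.map (Subgroup.inclusion hG) x) := by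
  induction x using QuotientGroup.induction_on with
  | H y =>
    refine (congrArg _ (heckeOperator_of G' H' t y)).trans
      (Eq.trans ?_ (heckeOperator_of G H t (Subgroup.inclusion hG y)).symm)
    rw [transfer_map]
    refine (transfer_comp _ _ (Subgroup.inclusion hG) (fun g => ?_) (fun g => ?_) _ _
      (fun l => rfl) y).symm
    · exact ⟨fun h => hH h, fun h => h1 g g.2 h⟩
    · obtain ⟨g', hg', h⟩ := h2 g g.2
      exact ⟨⟨g', hg'⟩, h⟩

end HeckeFunctoriality

/-! ### Abelianizations of a group and of a normal subgroup with quotient generated by one element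
-/

section CyclicQuotient

open scoped commutatorElement

variable {T : Type*} [Group T]

/-- If `H` is the union of its subgroup `K` and the coset `Kσ`, where `σ` normalizes `K`, then the
kernel of `Kᵃᵇ → Hᵃᵇ` consists of the `σyσ⁻¹ / y`. -/
theorem exists_eq_conj_div_of_map_eq_one {K H : Subgroup T} (hKH : K ≤ H) (σ : T)
    (hK : ∀ h ∈ H, h ∈ K ∨ h * σ⁻¹ ∈ K) (hn : ∀ k ∈ K, σ * k * σ⁻¹ ∈ K)
    (c : Abelianization K →* Abelianization K)
    (hc : ∀ k : K, c (Abelianization.of k) = Abelianization.of ⟨σ * k * σ⁻¹, hn k k.2⟩)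
    (x : Abelianization K) (hx : Abelianization.map (Subgroup.inclusion hKH) x = 1) :
    ∃ y, x = c y / y := by
  -- `L` consists of the elements of K whose class is in the image of c - 1, seen in H. It suffices
  -- that `L` contains every commutator of H.
  let D : Subgroup (Abelianization K) := (c / MonoidHom.id _).range
  have hD : ∀ y, c y / y ∈ D := fun y => ⟨y, rfl⟩
  let L : Subgroup H := (D.comap Abelianization.of).map (Subgroup.inclusion hKH)
  have hL : ∀ (a : H) (k : K), (k : T) = a → Abelianization.of k ∈ D → a ∈ L := fun a k h hk =>
    ⟨k, hk, Subtype.ext h⟩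
  have key : ∀ k l : K, ∀ a b : H, (a : T) = k → ((b : T) = l ∨ (b : T) = l * σ) → ⁅a, b⁆ ∈ L := by
    rintro k l a b ha (hb | hb)
    · refine hL _ ⁅k, l⁆ ?_ ?_
      · simp [commutatorElement_def, ha, hb]
      · rw [map_commutatorElement, commutatorElement_eq_one_iff_mul_comm.2 (mul_comm _ _)]
        exact D.one_mem
    -- ⁅k, lσ⁆ = k·l·σk⁻¹σ⁻¹·l⁻¹ has class k / c(k) in Kᵃᵇ.
    · refine hL _ (k * l * ⟨σ * (k⁻¹ : K) * σ⁻¹, hn _ (k⁻¹).2⟩ * l⁻¹) ?_ ?_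
      · simp [commutatorElement_def, ha, hb, mul_assoc]
      · rw [map_mul, map_mul, map_mul, ← hc k⁻¹, map_inv, map_inv, map_inv]
        have h3 := D.inv_mem (hD (Abelianization.of k))
        convert h3 using 1
        rw [inv_div, div_eq_mul_inv, mul_right_comm, mul_inv_cancel_right]
  have hcomm : commutator H ≤ L := by
    rw [commutator_def, Subgroup.commutator_le]
    rintro a - b -
    rcases hK a a.2 with ha | ha
    · rcases hK b b.2 with hb | hb
      · exact key ⟨a, ha⟩ ⟨b, hb⟩ a b rfl (Or.inl rfl)
      · exact key ⟨a, ha⟩ ⟨b * σ⁻¹, hb⟩ a b rfl (Or.inr (by simp))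
    · rcases hK b b.2 with hb | hb
      · rw [← commutatorElement_inv]
        exact L.inv_mem (key ⟨b, hb⟩ ⟨a * σ⁻¹, ha⟩ b a rfl (Or.inr (by simp)))
      · let k : K := ⟨a * σ⁻¹, ha⟩
        let l : K := ⟨b * σ⁻¹, hb⟩
        have hk : (a : T) = k * σ := by simp [k]
        have hl : (b : T) = l * σ := by simp [l]
        -- ⁅kσ, lσ⁆ = k·σlσ⁻¹·σk⁻¹σ⁻¹·l⁻¹ has class (c(k) / k)⁻¹·(c(l) / l): the cosets of powers
        -- σ², which need not be listed, cancel.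
        refine hL _ (k * ⟨σ * l * σ⁻¹, hn _ l.2⟩ * ⟨σ * (k⁻¹ : K) * σ⁻¹, hn _ (k⁻¹).2⟩ * l⁻¹) ?_ ?_
        · simp [commutatorElement_def, hk, hl, mul_assoc]
        · rw [map_mul, map_mul, map_mul, ← hc k⁻¹, ← hc l, map_inv, map_inv, map_inv]
          have h3 := D.mul_mem (D.inv_mem (hD (Abelianization.of k))) (hD (Abelianization.of l))
          convert h3 using 1
          rw [inv_div, div_eq_mul_inv, div_eq_mul_inv, mul_assoc, mul_assoc, mul_assoc]
          congr 1
          rw [mul_left_comm]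
  induction x using QuotientGroup.induction_on with
  | H k =>
    have h1 : Subgroup.inclusion hKH k ∈ commutator H := by
      rw [← Abelianization.ker_of]; exact hx
    obtain ⟨k', hk', h2⟩ := hcomm h1
    obtain rfl : k' = k := Subgroup.inclusion_injective hKH h2
    obtain ⟨y, hy⟩ := hk'
    exact ⟨y, hy.symm⟩

end CyclicQuotient

/-! ### Conjugation by t on congruence subgroups, and the intermediate group -/

section CongruenceSubgroups

open CongruenceSubgroup

/-- The image in `GL₂(ℚ)` of a subgroup of `SL₂(ℤ)`. -/
abbrev toGL (P : Subgroup SL(2, ℤ)) : Subgroup (GL (Fin 2) ℚ) :=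
  P.map (Matrix.SpecialLinearGroup.mapGL ℚ)

/-- Conjugation by t sends (a b; c d) to (a b/2; 2c d); the denominator is cleared. -/
theorem mapGL_eq_tMat_conj_iff (A B : SL(2, ℤ)) :
    Matrix.SpecialLinearGroup.mapGL ℚ B = tMat * Matrix.SpecialLinearGroup.mapGL ℚ A * tMat⁻¹ ↔
      2 * B 0 1 = A 0 1 ∧ B 0 0 = A 0 0 ∧ B 1 0 = 2 * A 1 0 ∧ B 1 1 = A 1 1 := by
  rw [eq_mul_inv_iff_mul_eq, Units.ext_iff, ← Matrix.ext_iff, Fin.forall_fin_two,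
    Fin.forall_fin_two, Fin.forall_fin_two, Units.val_mul, Units.val_mul, Matrix.mul_apply,
    Matrix.mul_apply, Matrix.mul_apply, Matrix.mul_apply, Matrix.mul_apply, Matrix.mul_apply,
    Matrix.mul_apply, Matrix.mul_apply]
  simp only [Fin.sum_univ_two]
  change ((((B 0 0 : ℤ) : ℚ) * 1 + (B 0 1 : ℤ) * 0 = 1 * (A 0 0 : ℤ) + 0 * (A 1 0 : ℤ) ∧
    ((B 0 0 : ℤ) : ℚ) * 0 + (B 0 1 : ℤ) * 2 = 1 * (A 0 1 : ℤ) + 0 * (A 1 1 : ℤ)) ∧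
    (((B 1 0 : ℤ) : ℚ) * 1 + (B 1 1 : ℤ) * 0 = 0 * (A 0 0 : ℤ) + 2 * (A 1 0 : ℤ) ∧
    ((B 1 0 : ℤ) : ℚ) * 0 + (B 1 1 : ℤ) * 2 = 0 * (A 0 1 : ℤ) + 2 * (A 1 1 : ℤ))) ↔ _
  constructor
  · rintro ⟨⟨h1, h2⟩, h3, h4⟩
    refine ⟨?_, ?_, ?_, ?_⟩
    · have : (2 : ℚ) * (B 0 1 : ℤ) = (A 0 1 : ℤ) := by linarith
      exact_mod_cast this
    · have : ((B 0 0 : ℤ) : ℚ) = (A 0 0 : ℤ) := by linarith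
      exact_mod_cast this
    · have : ((B 1 0 : ℤ) : ℚ) = 2 * (A 1 0 : ℤ) := by linarith
      exact_mod_cast this
    · have : ((B 1 1 : ℤ) : ℚ) = (A 1 1 : ℤ) := by linarith
      exact_mod_cast this
  · rintro ⟨h1, h2, h3, h4⟩
    rw [← h1, h2, h3, h4]
    push_cast
    refine ⟨⟨?_, ?_⟩, ?_, ?_⟩ <;> ring

theorem tMat_conj_mem_iff (Q : Subgroup SL(2, ℤ)) (A : SL(2, ℤ)) :
    tMat * Matrix.SpecialLinearGroup.mapGL ℚ A * tMat⁻¹ ∈ toGL Q ↔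
      ∃ B ∈ Q, 2 * B 0 1 = A 0 1 ∧ B 0 0 = A 0 0 ∧ B 1 0 = 2 * A 1 0 ∧ B 1 1 = A 1 1 :=
  exists_congr fun B => and_congr_right fun _ => mapGL_eq_tMat_conj_iff A B

/-- Conjugation by `t` maps the elements `(a b; c d)` of `P` with `b` even to `Q`, the matrix
`(1 1; 0 1)` is in `P`, and the elements of `P` are upper triangular mod `2`. -/
structure ConjStable (P Q : Subgroup SL(2, ℤ)) : Prop where
  le_Gamma0 : P ≤ Gamma0 2
  T_mem : ModularGroup.T ∈ P
  conj_mem : ∀ A ∈ P, ∀ B : SL(2, ℤ), 2 * B 0 1 = A 0 1 → B 0 0 = A 0 0 → B 1 0 = 2 * A 1 0 →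
    B 1 1 = A 1 1 → B ∈ Q

theorem SL2_det_eq (A : SL(2, ℤ)) : A 0 0 * A 1 1 - A 0 1 * A 1 0 = 1 := by
  rw [← Matrix.det_fin_two]; exact A.2

/-- Integrality of b/2 is the only obstruction. The criterion does not depend on P or Q, which is
why Hecke operators at different levels can be compared. -/
theorem ConjStable.conj_mem_iff {P Q : Subgroup SL(2, ℤ)} (h : ConjStable P Q) {A : SL(2, ℤ)}
    (hA : A ∈ P) :
    tMat * Matrix.SpecialLinearGroup.mapGL ℚ A * tMat⁻¹ ∈ toGL Q ↔ 2 ∣ A 0 1 := by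
  rw [tMat_conj_mem_iff]
  constructor
  · rintro ⟨B, -, hB, -⟩
    exact ⟨_, hB.symm⟩
  · rintro ⟨b, hb⟩
    have hdet : (!![A 0 0, b; 2 * A 1 0, A 1 1] : Matrix (Fin 2) (Fin 2) ℤ).det = 1 := by
      have := SL2_det_eq A
      rw [hb] at this
      rw [Matrix.det_fin_two_of]; linear_combination this
    exact ⟨⟨_, hdet⟩, h.conj_mem A hA _ hb.symm rfl rfl rfl, hb.symm, rfl, rfl, rfl⟩

theorem T_mul_apply_zero_one (A : SL(2, ℤ)) : (ModularGroup.T * A) 0 1 = A 0 1 + A 1 1 := by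
  rw [Matrix.SpecialLinearGroup.coe_mul, Matrix.mul_apply, Fin.sum_univ_two]
  simp [ModularGroup.T]

theorem T_inv_mul_apply_zero_one (A : SL(2, ℤ)) :
    (ModularGroup.T⁻¹ * A) 0 1 = A 0 1 - A 1 1 := by
  have := T_mul_apply_zero_one (ModularGroup.T⁻¹ * A)
  have h1 : (ModularGroup.T⁻¹ * A) 1 1 = A 1 1 := by
    rw [Matrix.SpecialLinearGroup.coe_mul, Matrix.mul_apply, Fin.sum_univ_two]
    rw [Matrix.SpecialLinearGroup.SL2_inv_expl]
    simp [ModularGroup.T]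
  rw [mul_inv_cancel_left, h1] at this
  linarith

theorem mul_T_apply_zero_one (A : SL(2, ℤ)) : (A * ModularGroup.T) 0 1 = A 0 0 + A 0 1 := by
  rw [Matrix.SpecialLinearGroup.coe_mul, Matrix.mul_apply, Fin.sum_univ_two]
  simp [ModularGroup.T]

theorem odd_of_mem_Gamma0 {A : SL(2, ℤ)} (hA : A ∈ Gamma0 2) :
    ¬ 2 ∣ A 0 0 ∧ ¬ 2 ∣ A 1 1 := by
  have h1 : (2 : ℤ) ∣ A 1 0 := (ZMod.intCast_zmod_eq_zero_iff_dvd _ _).1 (Gamma0_mem.1 hA)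
  have h2 := SL2_det_eq A
  constructor
  · intro h
    have : (2 : ℤ) ∣ 1 := h2 ▸ dvd_sub (h.mul_right _) (h1.mul_left _)
    omega
  · intro h
    have : (2 : ℤ) ∣ 1 := h2 ▸ dvd_sub (h.mul_left _) (h1.mul_left _)
    omega

/-- Since a is odd, exactly one of b and a + b is even, and a + b is the upper right entry of AT. So
1 and T represent the two cosets. -/
theorem ConjStable.index_eq_two {P Q : Subgroup SL(2, ℤ)} (h : ConjStable P Q) :
    (heckeSubgroup (toGL P) (toGL Q) tMat).index = 2 := by
  rw [Subgroup.index_eq_two_iff]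
  refine ⟨⟨_, _, h.T_mem, rfl⟩, ?_⟩
  rintro ⟨_, A, hA, rfl⟩
  have hA : A ∈ P := hA
  rw [mem_heckeSubgroup, mem_heckeSubgroup]
  change Xor (tMat * (Matrix.SpecialLinearGroup.mapGL ℚ A * Matrix.SpecialLinearGroup.mapGL ℚ
    ModularGroup.T) * tMat⁻¹ ∈ toGL Q)
    (tMat * Matrix.SpecialLinearGroup.mapGL ℚ A * tMat⁻¹ ∈ toGL Q)
  rw [← map_mul, h.conj_mem_iff hA, h.conj_mem_iff (P.mul_mem hA h.T_mem), mul_T_apply_zero_one]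
  have := (odd_of_mem_Gamma0 (h.le_Gamma0 hA)).1
  unfold Xor
  omega

theorem ConjStable.finiteIndex {P Q : Subgroup SL(2, ℤ)} (h : ConjStable P Q) :
    (heckeSubgroup (toGL P) (toGL Q) tMat).FiniteIndex :=
  ⟨by rw [h.index_eq_two]; exact two_ne_zero⟩

/-- The Hecke operators of `t` commute with the maps induced by inclusions. -/
theorem ConjStable.heckeOperator_inclusion {P Q P' Q' : Subgroup SL(2, ℤ)} (h : ConjStable P Q)
    (h' : ConjStable P' Q') (hP : P' ≤ P) (hQ : toGL Q' ≤ toGL Q) (hP' : toGL P' ≤ toGL P)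
    [(heckeSubgroup (toGL P) (toGL Q) tMat).FiniteIndex]
    [(heckeSubgroup (toGL P') (toGL Q') tMat).FiniteIndex] (x : Abelianization (toGL P')) :
    Abelianization.map (Subgroup.inclusion hQ) (heckeOperator (toGL P') (toGL Q') tMat x) =
      heckeOperator (toGL P) (toGL Q) tMat (Abelianization.map (Subgroup.inclusion hP') x) := by
  refine TwoAdicControl.heckeOperator_inclusion hP' hQ tMat ?_ ?_ x
  · rintro _ ⟨A, hA, rfl⟩ hm
    rw [h.conj_mem_iff (hP hA)] at hm
    exact (h'.conj_mem_iff hA).2 hm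
  · rintro _ ⟨A, hA, rfl⟩
    have hA : A ∈ P := hA
    -- T lies in the smaller group too, so 1 and T also represent the cosets of the larger one: if b
    -- is odd, then b - d is even.
    by_cases hd : 2 ∣ A 0 1
    · exact ⟨1, Subgroup.one_mem _, by rw [inv_one, one_mul]; exact (h.conj_mem_iff hA).2 hd⟩
    · refine ⟨_, ⟨_, h'.T_mem, rfl⟩, ?_⟩
      rw [← map_inv, ← map_mul,
        h.conj_mem_iff (P.mul_mem (P.inv_mem (hP h'.T_mem)) hA), T_inv_mul_apply_zero_one]
      have := (odd_of_mem_Gamma0 (h.le_Gamma0 hA)).2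
      omega

theorem intCast_eq_one_iff {n : ℕ} {x : ℤ} : (x : ZMod n) = 1 ↔ (n : ℤ) ∣ x - 1 := by
  rw [eq_comm, ← Int.cast_one, ZMod.intCast_eq_intCast_iff_dvd_sub]

theorem mem_Gamma1_iff {n : ℕ} {A : SL(2, ℤ)} : A ∈ Gamma1 n ↔
    (n : ℤ) ∣ A 0 0 - 1 ∧ (n : ℤ) ∣ A 1 1 - 1 ∧ (n : ℤ) ∣ A 1 0 := by
  rw [Gamma1_mem, intCast_eq_one_iff, intCast_eq_one_iff, ZMod.intCast_zmod_eq_zero_iff_dvd]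

theorem mem_Gamma0_iff {n : ℕ} {A : SL(2, ℤ)} : A ∈ Gamma0 n ↔ (n : ℤ) ∣ A 1 0 := by
  rw [Gamma0_mem, ZMod.intCast_zmod_eq_zero_iff_dvd]

theorem mem_Gamma1_of_mem_Gamma0 {n : ℕ} {A : SL(2, ℤ)} (h0 : A ∈ Gamma0 n)
    (h : (n : ℤ) ∣ A 1 1 - 1) : A ∈ Gamma1 n := by
  rw [mem_Gamma0_iff] at h0
  refine mem_Gamma1_iff.2 ⟨?_, h, h0⟩
  have : A 0 0 - 1 = -A 0 0 * (A 1 1 - 1) + A 0 1 * A 1 0 := by linear_combination SL2_det_eq A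
  rw [this]
  exact dvd_add (h.mul_left _) (h0.mul_left _)

/-- On Γ₀(n) the lower right entry mod n is a character with kernel Γ₁(n). -/
theorem mul_inv_mem_Gamma1 {n : ℕ} {A B : SL(2, ℤ)} (hA : A ∈ Gamma0 n) (hB : B ∈ Gamma0 n)
    (h : (n : ℤ) ∣ A 1 1 - B 1 1) : A * B⁻¹ ∈ Gamma1 n := by
  refine mem_Gamma1_of_mem_Gamma0 (Subgroup.mul_mem _ hA (Subgroup.inv_mem _ hB)) ?_
  have h1 : (A * B⁻¹) 1 1 = - A 1 0 * B 0 1 + A 1 1 * B 0 0 := by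
    rw [Matrix.SpecialLinearGroup.coe_mul, Matrix.mul_apply, Fin.sum_univ_two]
    simp [Matrix.SpecialLinearGroup.SL2_inv_expl]
  rw [mem_Gamma0_iff] at hA hB
  have h2 : (A * B⁻¹) 1 1 - 1 = -B 0 1 * A 1 0 + (A 1 1 - B 1 1) * B 0 0 + B 0 1 * B 1 0 := by
    rw [h1]; linear_combination SL2_det_eq B
  rw [h2]
  exact dvd_add (dvd_add (hA.mul_left _) (h.mul_right _)) (hB.mul_left _)

theorem conjStable_Gamma1 {n : ℕ} (hn : 2 ∣ n) : ConjStable (Gamma1 n) (Gamma1 n) where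
  le_Gamma0 A hA := mem_Gamma0_iff.2
    ((Int.natCast_dvd_natCast.2 hn).trans (mem_Gamma1_iff.1 hA).2.2)
  T_mem := mem_Gamma1_iff.2 (by simp [ModularGroup.T])
  conj_mem A hA B _ h2 h3 h4 := by
    rw [mem_Gamma1_iff] at hA ⊢
    rw [h2, h3, h4]
    exact ⟨hA.1, hA.2.1, hA.2.2.mul_left _⟩

/-- The group `Γ₁(n) ∩ Γ₀(2n)`. -/
def midGamma (n : ℕ) : Subgroup SL(2, ℤ) := Gamma1 n ⊓ Gamma0 (n * 2)

theorem midGamma_le_Gamma1 (n : ℕ) : midGamma n ≤ Gamma1 n := inf_le_left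

theorem Gamma1_le_midGamma (n : ℕ) : Gamma1 (n * 2) ≤ midGamma n := by
  intro A hA
  have hd : (n : ℤ) ∣ ((n * 2 : ℕ) : ℤ) := Int.natCast_dvd_natCast.2 (dvd_mul_right _ _)
  rw [mem_Gamma1_iff] at hA
  exact ⟨mem_Gamma1_iff.2 ⟨hd.trans hA.1, hd.trans hA.2.1, hd.trans hA.2.2⟩,
    mem_Gamma0_iff.2 hA.2.2⟩

/-- The lower left entry becomes 2c, divisible by 2n. This is what makes `U` at level n factor
through the intermediate group. -/
theorem conjStable_Gamma1_midGamma {n : ℕ} (hn : 2 ∣ n) : ConjStable (Gamma1 n) (midGamma n) where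
  le_Gamma0 := (conjStable_Gamma1 hn).le_Gamma0
  T_mem := (conjStable_Gamma1 hn).T_mem
  conj_mem A hA B h1 h2 h3 h4 := by
    refine ⟨(conjStable_Gamma1 hn).conj_mem A hA B h1 h2 h3 h4, mem_Gamma0_iff.2 ?_⟩
    rw [h3, mul_comm n, Nat.cast_mul]
    exact mul_dvd_mul_left 2 (mem_Gamma1_iff.1 hA).2.2

theorem conjStable_midGamma {n : ℕ} (hn : 2 ∣ n) : ConjStable (midGamma n) (midGamma n) where
  le_Gamma0 := (midGamma_le_Gamma1 n).trans (conjStable_Gamma1 hn).le_Gamma0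
  T_mem := Gamma1_le_midGamma n (conjStable_Gamma1 (hn.mul_right 2)).T_mem
  conj_mem A hA := (conjStable_Gamma1_midGamma hn).conj_mem A hA.1

/-- In the intermediate group d is 1 or 1 + n mod 2n, so Γ₁(2n) has at most one coset other than
itself. -/
theorem mul_inv_mem_Gamma1_of_midGamma {n : ℕ} {A B : SL(2, ℤ)} (hA : A ∈ midGamma n)
    (hB : B ∈ midGamma n) (hA' : A ∉ Gamma1 (n * 2)) (hB' : B ∉ Gamma1 (n * 2)) :
    A * B⁻¹ ∈ Gamma1 (n * 2) := by
  have key : ∀ C ∈ midGamma n, C ∉ Gamma1 (n * 2) → ∃ k, C 1 1 = 1 + n * (2 * k + 1) := by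
    intro C hC hC'
    obtain ⟨k, hk⟩ := (mem_Gamma1_iff.1 hC.1).2.1
    rcases Int.even_or_odd' k with ⟨l, rfl | rfl⟩
    · exact absurd (mem_Gamma1_of_mem_Gamma0 hC.2 ⟨l, by push_cast; linear_combination hk⟩) hC'
    · exact ⟨l, by linear_combination hk⟩
  obtain ⟨k, hk⟩ := key A hA hA'
  obtain ⟨l, hl⟩ := key B hB hB'
  exact mul_inv_mem_Gamma1 hA.2 hB.2 ⟨k - l, by rw [hk, hl]; push_cast; ring⟩

theorem mul_self_mem_Gamma1_of_midGamma {n : ℕ} {A : SL(2, ℤ)} (hA : A ∈ midGamma n) :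
    A * A ∈ Gamma1 (n * 2) := by
  by_cases h : A ∈ Gamma1 (n * 2)
  · exact Subgroup.mul_mem _ h h
  · have := mul_inv_mem_Gamma1_of_midGamma hA ((midGamma n).inv_mem hA) h
      fun h' => h (by simpa using (Gamma1 (n * 2)).inv_mem h')
    rwa [inv_inv] at this

/-- `U` maps `(Γ₁(n) ∩ Γ₀(2n))ᵃᵇ` into the image of `Γ₁(m)ᵃᵇ`, where `m = 2n`. -/
theorem heckeOperator_midGamma_mem_range {n m : ℕ} (hn : 2 ∣ n) (hm : m = n * 2)
    [(heckeSubgroup (toGL (midGamma n)) (toGL (midGamma n)) tMat).FiniteIndex]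
    (hle : toGL (Gamma1 m) ≤ toGL (midGamma n)) (x : Abelianization (toGL (midGamma n))) :
    heckeOperator (toGL (midGamma n)) (toGL (midGamma n)) tMat x ∈
      (Abelianization.map (Subgroup.inclusion hle)).range := by
  subst hm
  set R := (Abelianization.map (Subgroup.inclusion hle)).range with hR
  have hmem : ∀ h : toGL (midGamma n), (h : GL (Fin 2) ℚ) ∈ toGL (Gamma1 (n * 2)) →
      Abelianization.of h ∈ R := fun h hh => ⟨Abelianization.of ⟨h, hh⟩, rfl⟩
  induction x using QuotientGroup.induction_on with
  | H y =>
    rw [← QuotientGroup.eq_one_iff]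
    refine (congrArg (QuotientGroup.mk' R) (heckeOperator_of _ _ tMat y)).trans ?_
    rw [transfer_map]
    -- Conjugation by t does not change d, so A and tAt⁻¹ have the same class modulo Γ₁(2n). Modulo
    -- `R` the operator is thus the transfer of a restricted homomorphism, a power with exponent the
    -- index 2, and squares lie in Γ₁(2n).
    have h1 : (QuotientGroup.mk' R).comp ((Abelianization.of : toGL (midGamma n) →* _).comp
        (heckeConj (toGL (midGamma n)) (toGL (midGamma n)) tMat)) =
        ((QuotientGroup.mk' R).comp (Abelianization.of : toGL (midGamma n) →* _)).comp
          (heckeSubgroup (toGL (midGamma n)) (toGL (midGamma n)) tMat).subtype := by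
      refine MonoidHom.ext ?_
      rintro ⟨⟨_, A, hA, rfl⟩, hc⟩
      refine (QuotientGroup.eq.2 ?_).symm
      change (Abelianization.of _)⁻¹ * Abelianization.of _ ∈ R
      rw [mul_comm, ← map_inv, ← map_mul]
      refine hmem _ ?_
      obtain ⟨C, hC, hC'⟩ := hc
      change tMat * Matrix.SpecialLinearGroup.mapGL ℚ A * tMat⁻¹ *
        (Matrix.SpecialLinearGroup.mapGL ℚ A)⁻¹ ∈ _
      have hC'' : Matrix.SpecialLinearGroup.mapGL ℚ C =
        tMat * Matrix.SpecialLinearGroup.mapGL ℚ A * tMat⁻¹ := hC'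
      have hCd : C 1 1 = A 1 1 := ((mapGL_eq_tMat_conj_iff A C).1 hC'').2.2.2
      rw [← hC'', ← map_inv, ← map_mul]
      exact ⟨_, mul_inv_mem_Gamma1 hC.2 hA.2 (by rw [hCd, sub_self]; exact dvd_zero _), rfl⟩
    rw [h1, transfer_restrict, (conjStable_midGamma hn).index_eq_two, ← map_pow]
    obtain ⟨_, A, hA, rfl⟩ := y
    refine (QuotientGroup.eq_one_iff _).2 (hmem _ ?_)
    change Matrix.SpecialLinearGroup.mapGL ℚ A ^ 2 ∈ _
    rw [← map_pow, pow_two]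
    exact ⟨_, mul_self_mem_Gamma1_of_midGamma hA, rfl⟩

end CongruenceSubgroups

/-! ### Extension of scalars from ℤ to ℤ₂ -/

section TensorAb

variable {A B C : Type*} [CommGroup A] [CommGroup B] [CommGroup C]

theorem extend_div_id (f : A →* A) : extend (f / MonoidHom.id A) = extend f - LinearMap.id :=
  extend_ext fun c a => by
    rw [LinearMap.sub_apply, extend_tmul, extend_tmul, MonoidHom.div_apply, ofMul_div,
      TensorProduct.tmul_sub]
    rfl

/-- ℤ₂ is flat over ℤ, so exactness in the middle is preserved although g need not be surjective. -/
theorem exists_extend_eq_of_extend_eq_zero (f : A →* B) (g : B →* C)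
    (h : ∀ b, g b = 1 ↔ ∃ a, f a = b) {x : TensorAb B} (hx : extend g x = 0) :
    ∃ z, extend f z = x := by
  have h1 : Function.Exact (MonoidHom.toAdditive f).toIntLinearMap
      (MonoidHom.toAdditive g).toIntLinearMap := fun b => h (Additive.toMul b)
  exact (Module.Flat.lTensor_exact ℤ_[2] h1 x).1 hx

theorem extend_mem_range (f : A →* C) (g : B →* C) (h : ∀ a, f a ∈ g.range) (x : TensorAb A) :
    ∃ z, extend g z = extend f x := by
  induction x using TensorProduct.induction_on with
  | zero => exact ⟨0, by rw [map_zero, map_zero]⟩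
  | tmul c a =>
    obtain ⟨b, hb⟩ := h (Additive.toMul a)
    refine ⟨c ⊗ₜ[ℤ] Additive.ofMul b, ?_⟩
    rw [extend_tmul, hb]
    rfl
  | add x y hx hy =>
    obtain ⟨a, ha⟩ := hx
    obtain ⟨b, hb⟩ := hy
    exact ⟨a + b, by rw [map_add, map_add, ha, hb]⟩

theorem extend_extend (f : B →* C) (g : A →* B) (x : TensorAb A) :
    extend f (extend g x) = extend (f.comp g) x := by
  rw [extend_comp]; rfl

theorem tensorAb_finite (G : Type*) [Group G] [Group.FG G] :
    Module.Finite ℤ_[2] (TensorAb (Abelianization G)) := by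
  have h1 : Group.FG (Abelianization G) :=
    Group.fg_of_surjective (f := (Abelianization.of : G →* _)) (QuotientGroup.mk'_surjective _)
  have h2 : Module.Finite ℤ (Additive (Abelianization G)) :=
    Module.Finite.iff_addGroup_fg.2 (GroupFG.iff_add_fg.1 h1)
  infer_instance

end TensorAb

/-! ### One step of the tower: from Γ₁(2n) to Γ₁(n) -/

section OneStep

open CongruenceSubgroup

/-- SL₂(ℤ) is finitely generated, and so are its subgroups of finite index. -/
theorem tensorAb_toGL_finite (P : Subgroup SL(2, ℤ)) [P.FiniteIndex] :
    Module.Finite ℤ_[2] (TensorAb (Abelianization (toGL P))) := by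
  have h1 : Group.FG SL(2, ℤ) :=
    Group.fg_iff.2 ⟨_, SpecialLinearGroup.SL2Z_generators, Set.toFinite _⟩
  have h2 : Group.FG P := inferInstance
  have h3 : Group.FG (toGL P) :=
    Group.fg_of_surjective (f := (Matrix.SpecialLinearGroup.mapGL ℚ).subgroupMap P)
      (MonoidHom.subgroupMap_surjective _ _)
  exact tensorAb_finite _

/-- The operator `U` on `Pᵃᵇ ⊗ ℤ₂`. -/
abbrev tensorU (P : Subgroup SL(2, ℤ)) [(heckeSubgroup (toGL P) (toGL P) tMat).FiniteIndex] :
    Module.End ℤ_[2] (TensorAb (Abelianization (toGL P))) :=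
  extend (heckeOperator (toGL P) (toGL P) tMat)

/-- The map `Pᵃᵇ ⊗ ℤ₂ → Qᵃᵇ ⊗ ℤ₂` induced by an inclusion. -/
abbrev tensorIncl {P Q : Subgroup SL(2, ℤ)} (h : toGL P ≤ toGL Q) :
    TensorAb (Abelianization (toGL P)) →ₗ[ℤ_[2]] TensorAb (Abelianization (toGL Q)) :=
  extend (Abelianization.map (Subgroup.inclusion h))

theorem tensorIncl_tensorU {P Q : Subgroup SL(2, ℤ)}
    [(heckeSubgroup (toGL P) (toGL P) tMat).FiniteIndex]
    [(heckeSubgroup (toGL Q) (toGL Q) tMat).FiniteIndex] (hP : ConjStable P P)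
    (hQ : ConjStable Q Q) (h : P ≤ Q) (h' : toGL P ≤ toGL Q)
    (x : TensorAb (Abelianization (toGL P))) :
    tensorIncl h' (tensorU P x) = tensorU Q (tensorIncl h' x) := by
  rw [extend_extend, extend_extend]
  exact LinearMap.congr_fun (congrArg extend
    (MonoidHom.ext fun y => hQ.heckeOperator_inclusion hP h h' h' y)) x

theorem tensorIncl_trans {P Q S : Subgroup SL(2, ℤ)} (h : toGL P ≤ toGL Q) (h' : toGL Q ≤ toGL S)
    (h'' : toGL P ≤ toGL S) (x : TensorAb (Abelianization (toGL P))) :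
    tensorIncl h' (tensorIncl h x) = tensorIncl h'' x := by
  rw [extend_extend]
  refine LinearMap.congr_fun (congrArg extend (MonoidHom.ext fun y => ?_)) x
  induction y using QuotientGroup.induction_on with
  | H z => rfl

variable {n m : ℕ}

/-- V is the Hecke operator of t from Γ₁(n) to the intermediate group. Both identities say that
Hecke operators of t commute with inclusions. As `U` is invertible on ordinary parts, they make the
inclusion an isomorphism there. -/
theorem exists_tensorIncl_midGamma_eq_tensorU (hn : 2 ∣ n)
    [(heckeSubgroup (toGL (Gamma1 n)) (toGL (Gamma1 n)) tMat).FiniteIndex]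
    [(heckeSubgroup (toGL (midGamma n)) (toGL (midGamma n)) tMat).FiniteIndex]
    (h : toGL (midGamma n) ≤ toGL (Gamma1 n)) :
    ∃ V : TensorAb (Abelianization (toGL (Gamma1 n))) →ₗ[ℤ_[2]]
        TensorAb (Abelianization (toGL (midGamma n))),
      (∀ x, tensorIncl h (V x) = tensorU _ x) ∧ ∀ x, V (tensorIncl h x) = tensorU _ x := by
  have hGH := conjStable_Gamma1_midGamma hn
  have := hGH.finiteIndex
  refine ⟨extend (heckeOperator (toGL (Gamma1 n)) (toGL (midGamma n)) tMat), fun x => ?_,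
    fun x => ?_⟩
  · rw [extend_extend]
    refine LinearMap.congr_fun (congrArg extend (MonoidHom.ext fun y => ?_)) x
    refine ((conjStable_Gamma1 hn).heckeOperator_inclusion hGH le_rfl h le_rfl y).trans
      (congrArg _ ?_)
    induction y using QuotientGroup.induction_on with
    | H z => rfl
  · rw [extend_extend]
    refine LinearMap.congr_fun (congrArg extend (MonoidHom.ext fun y => ?_)) x
    refine (hGH.heckeOperator_inclusion (conjStable_midGamma hn) (midGamma_le_Gamma1 n) le_rfl h
      y).symm.trans ?_
    generalize heckeOperator (toGL (midGamma n)) (toGL (midGamma n)) tMat y = w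
    induction w using QuotientGroup.induction_on with
    | H z => rfl

theorem midGamma_finiteIndex [NeZero n] : (midGamma n).FiniteIndex := by
  have : NeZero (n * 2) := ⟨mul_ne_zero (NeZero.ne n) two_ne_zero⟩
  exact Subgroup.finiteIndex_of_le (Gamma1_le_midGamma n)

/-- The map `Γ₁(2n)ᵃᵇ ⊗ ℤ₂ → Γ₁(n)ᵃᵇ ⊗ ℤ₂` is surjective on ordinary parts. -/
theorem exists_ordinary_tensorIncl_eq [NeZero n] (hn : 2 ∣ n) (hm : m = n * 2)
    [(heckeSubgroup (toGL (Gamma1 n)) (toGL (Gamma1 n)) tMat).FiniteIndex]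
    [(heckeSubgroup (toGL (Gamma1 m)) (toGL (Gamma1 m)) tMat).FiniteIndex]
    (h : toGL (Gamma1 m) ≤ toGL (Gamma1 n)) {y : TensorAb (Abelianization (toGL (Gamma1 n)))}
    (hy : y ∈ ordinaryPart (tensorU (Gamma1 n))) :
    ∃ x ∈ ordinaryPart (tensorU (Gamma1 m)), tensorIncl h x = y := by
  have hH := conjStable_midGamma hn
  have := hH.finiteIndex
  have hn2 := hn.mul_right 2
  rw [← hm] at hn2
  have hKH' : Gamma1 m ≤ midGamma n := hm ▸ Gamma1_le_midGamma n
  have hKH : toGL (Gamma1 m) ≤ toGL (midGamma n) := Subgroup.map_mono hKH'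
  have hHG : toGL (midGamma n) ≤ toGL (Gamma1 n) := Subgroup.map_mono (midGamma_le_Gamma1 n)
  have : (midGamma n).FiniteIndex := midGamma_finiteIndex
  have : NeZero m := ⟨hm ▸ mul_ne_zero (NeZero.ne n) two_ne_zero⟩
  have := tensorAb_toGL_finite (midGamma n)
  have := tensorAb_toGL_finite (Gamma1 m)
  obtain ⟨V, hV1, hV2⟩ := exists_tensorIncl_midGamma_eq_tensorU hn hHG
  -- With y = Uy', the element Vy' maps to y. It is ordinary, hence a value of `U` on the
  -- intermediate group, hence the image of some k from Γ₁(2n); k can then be replaced by an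
  -- ordinary element.
  obtain ⟨y', hy', rfl⟩ := exists_ordinary_apply_eq hy
  have hz := map_mem_ordinaryPart V (U' := tensorU (midGamma n))
    (fun x => by rw [← hV1, hV2]) hy'
  obtain ⟨z', -, hz'⟩ := exists_ordinary_apply_eq hz
  obtain ⟨k, hk⟩ := extend_mem_range _ _ (heckeOperator_midGamma_mem_range hn hm hKH) z'
  have hk' : tensorIncl hKH k = V y' := hk.trans hz'
  obtain ⟨x, hx, hxk⟩ := exists_ordinary_preimage (U := tensorU (Gamma1 m))
    (U' := tensorU (midGamma n)) (tensorIncl hKH)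
    (fun x => tensorIncl_tensorU (conjStable_Gamma1 hn2) hH hKH' hKH x) (m := k) (by rwa [hk'])
  refine ⟨x, hx, ?_⟩
  rw [← tensorIncl_trans hKH hHG h, hxk, hk', hV1]

/-- The kernel of `Γ₁(2n)ᵃᵇ ⊗ ℤ₂ → Γ₁(n)ᵃᵇ ⊗ ℤ₂` on ordinary parts is generated by the
differences `cy - y`, where `c` is conjugation by an element of `Γ₁(n) ∩ Γ₀(2n)` outside
`Γ₁(2n)`. -/
theorem exists_ordinary_eq_conj_sub [NeZero n] (hn : 2 ∣ n) (hm : m = n * 2)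
    [(heckeSubgroup (toGL (Gamma1 n)) (toGL (Gamma1 n)) tMat).FiniteIndex]
    [(heckeSubgroup (toGL (Gamma1 m)) (toGL (Gamma1 m)) tMat).FiniteIndex]
    (h : toGL (Gamma1 m) ≤ toGL (Gamma1 n)) {A : SL(2, ℤ)} (hA : A ∈ midGamma n)
    (hA' : A ∉ Gamma1 m)
    (hn' : ∀ k ∈ toGL (Gamma1 m), Matrix.SpecialLinearGroup.mapGL ℚ A * k *
      (Matrix.SpecialLinearGroup.mapGL ℚ A)⁻¹ ∈ toGL (Gamma1 m))
    (c : Abelianization (toGL (Gamma1 m)) →* Abelianization (toGL (Gamma1 m)))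
    (hc : ∀ k : toGL (Gamma1 m), c (Abelianization.of k) =
      Abelianization.of ⟨Matrix.SpecialLinearGroup.mapGL ℚ A * k *
        (Matrix.SpecialLinearGroup.mapGL ℚ A)⁻¹, hn' k k.2⟩)
    (hcU : ∀ x, c (heckeOperator (toGL (Gamma1 m)) (toGL (Gamma1 m)) tMat x) =
      heckeOperator (toGL (Gamma1 m)) (toGL (Gamma1 m)) tMat (c x))
    {x : TensorAb (Abelianization (toGL (Gamma1 m)))} (hx : x ∈ ordinaryPart (tensorU (Gamma1 m)))
    (hx0 : tensorIncl h x = 0) :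
    ∃ y ∈ ordinaryPart (tensorU (Gamma1 m)), x = extend c y - y := by
  have hH := conjStable_midGamma hn
  have := hH.finiteIndex
  have hn2 := hn.mul_right 2
  rw [← hm] at hn2
  have hKH' : Gamma1 m ≤ midGamma n := hm ▸ Gamma1_le_midGamma n
  have hKH : toGL (Gamma1 m) ≤ toGL (midGamma n) := Subgroup.map_mono hKH'
  have hHG : toGL (midGamma n) ≤ toGL (Gamma1 n) := Subgroup.map_mono (midGamma_le_Gamma1 n)
  have : NeZero m := ⟨hm ▸ mul_ne_zero (NeZero.ne n) two_ne_zero⟩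
  have := tensorAb_toGL_finite (Gamma1 m)
  obtain ⟨V, hV1, hV2⟩ := exists_tensorIncl_midGamma_eq_tensorU hn hHG
  -- Applying V to the image of x in Γ₁(n) gives `U` of its image in the intermediate group, and `U`
  -- is injective on ordinary elements.
  have h1 : tensorIncl hKH x = 0 := by
    refine eq_zero_of_mem_ordinaryPart_of_apply_eq_zero (map_mem_ordinaryPart (tensorIncl hKH)
      (U' := tensorU (midGamma n))
      (fun x => tensorIncl_tensorU (conjStable_Gamma1 hn2) hH hKH' hKH x) hx) ?_
    rw [← hV2, tensorIncl_trans hKH hHG h, hx0, map_zero]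
  have hcoset : ∀ g ∈ toGL (midGamma n), g ∈ toGL (Gamma1 m) ∨
      g * (Matrix.SpecialLinearGroup.mapGL ℚ A)⁻¹ ∈ toGL (Gamma1 m) := by
    rintro _ ⟨B, hB, rfl⟩
    by_cases hB' : B ∈ Gamma1 m
    · exact Or.inl ⟨B, hB', rfl⟩
    · right
      rw [← map_inv, ← map_mul]
      subst hm
      exact ⟨_, mul_inv_mem_Gamma1_of_midGamma hB hA hB' hA', rfl⟩
  have hexact : ∀ b, Abelianization.map (Subgroup.inclusion hKH) b = 1 ↔
      ∃ a, c a / a = b := by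
    refine fun b => ⟨fun hb => ?_, ?_⟩
    · obtain ⟨y, hy⟩ := exists_eq_conj_div_of_map_eq_one hKH _ hcoset hn' c hc b hb
      exact ⟨y, hy.symm⟩
    · rintro ⟨a, rfl⟩
      induction a using QuotientGroup.induction_on with
      | H k =>
        refine (congrArg (fun w => Abelianization.map (Subgroup.inclusion hKH)
          (w / Abelianization.of k)) (hc k)).trans ?_
        rw [map_div, Abelianization.map_of, Abelianization.map_of, div_eq_one]
        have h3 : Subgroup.inclusion hKH ⟨_, hn' k k.2⟩ =
            (⟨_, A, hA, rfl⟩ : toGL (midGamma n)) * Subgroup.inclusion hKH k *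
              (⟨_, A, hA, rfl⟩ : toGL (midGamma n))⁻¹ := rfl
        rw [h3, map_mul, map_mul, map_inv, mul_right_comm, mul_inv_cancel, one_mul]
  obtain ⟨z, hz⟩ := exists_extend_eq_of_extend_eq_zero (c / MonoidHom.id _) _ hexact h1
  -- Since c commutes with `U`, the solution z of (c - 1)z = x can be replaced by an ordinary one.
  obtain ⟨y, hy, hyz⟩ := exists_ordinary_preimage (U := tensorU (Gamma1 m))
    (U' := tensorU (Gamma1 m)) (extend (c / MonoidHom.id _)) (fun x => by
      rw [extend_div_id, LinearMap.sub_apply, LinearMap.sub_apply, map_sub, extend_extend,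
        extend_extend]
      congr 1
      exact LinearMap.congr_fun (congrArg extend (MonoidHom.ext hcU)) x) (m := z) (by rwa [hz])
  refine ⟨y, hy, ?_⟩
  rw [← hz, ← hyz, extend_div_id]
  rfl

end OneStep

/-! ### The filtration of Γ by the subgroups Γ_r -/

section Gamma

theorem mem_padicSubgroup_iff_dvd {r : ℕ} {x : ℤ_[2]ˣ} :
    x ∈ padicSubgroup r ↔ (2 ^ r : ℤ_[2]) ∣ (x : ℤ_[2]) - 1 := by
  rw [mem_padicSubgroup, ← sub_eq_zero, ← map_one (PadicInt.toZModPow r), ← map_sub,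
    ← RingHom.mem_ker, PadicInt.ker_toZModPow, Ideal.mem_span_singleton]
  norm_num

/-- As x ≡ 1 mod 4, x + 1 is 2 times a unit, so x² - 1 = (x - 1)(x + 1) has exactly one more factor
2 than x - 1. Hence squaring takes Γ_s ∖ Γ_{s+1} to Γ_{s+1} ∖ Γ_{s+2}. -/
theorem sq_mem_padicSubgroup {s : ℕ} (hs : 2 ≤ s) {x : ℤ_[2]ˣ} (hx : x ∈ padicSubgroup s) :
    x ^ 2 ∈ padicSubgroup (s + 1) ∧ (x ^ 2 ∈ padicSubgroup (s + 2) → x ∈ padicSubgroup (s + 1)) := by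
  rw [mem_padicSubgroup_iff_dvd] at hx
  simp only [mem_padicSubgroup_iff_dvd, Units.val_pow_eq_pow_val]
  obtain ⟨v, hv⟩ := hx
  obtain ⟨k, rfl⟩ := Nat.exists_eq_add_of_le hs
  have h1 : (x : ℤ_[2]) ^ 2 - 1 = 2 * ((x : ℤ_[2]) - 1) * (1 + 2 * (2 ^ k * v)) := by
    linear_combination ((x : ℤ_[2]) - 1) * hv
  have hu : IsUnit (1 + 2 * (2 ^ k * v) : ℤ_[2]) := by
    by_contra h
    have h2 : (2 * (2 ^ k * v) : ℤ_[2]) ∈ IsLocalRing.maximalIdeal ℤ_[2] := by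
      rw [PadicInt.maximalIdeal_eq_span_p]
      exact Ideal.mul_mem_right _ _ (Ideal.mem_span_singleton_self _)
    have h3 := (IsLocalRing.maximalIdeal ℤ_[2]).sub_mem ((IsLocalRing.mem_maximalIdeal _).2 h) h2
    rw [add_sub_cancel_right] at h3
    exact (IsLocalRing.mem_maximalIdeal _).1 h3 isUnit_one
  rw [h1]
  refine ⟨Dvd.dvd.mul_right ⟨v, by rw [hv]; ring⟩ _, fun h => ?_⟩
  rw [hu.dvd_mul_right] at h
  have h2 : (2 : ℤ_[2]) ^ (2 + k + 2) = 2 * 2 ^ (2 + k + 1) := by ring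
  rw [h2] at h
  exact (mul_dvd_mul_iff_left two_ne_zero).1 h

theorem exists_mem_padicSubgroup_not_mem_succ {s : ℕ} (hs : 2 ≤ s) :
    ∃ γ : Gam, (γ : ℤ_[2]ˣ) ∈ padicSubgroup s ∧ (γ : ℤ_[2]ˣ) ∉ padicSubgroup (s + 1) := by
  obtain ⟨k, rfl⟩ := Nat.exists_eq_add_of_le hs
  have h1 : ((1 + 2 ^ (2 + k) : ℤ) : ZMod (2 ^ 2)) = 1 :=
    intCast_eq_one_iff.2 ⟨2 ^ k, by push_cast; ring⟩
  -- The element is 1 + 2^s, where s = 2 + k.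
  refine ⟨gamOfInt _ h1, ?_, ?_⟩
  · rw [mem_padicSubgroup, toZModPow_gamOfInt, intCast_eq_one_iff]
    exact ⟨1, by push_cast; ring⟩
  · rw [mem_padicSubgroup, toZModPow_gamOfInt, intCast_eq_one_iff]
    rintro ⟨l, hl⟩
    push_cast at hl
    have h2 : (2 : ℤ) ^ (2 + k) * 1 = 2 ^ (2 + k) * (2 * l) := by linear_combination hl
    have := mul_left_cancel₀ (pow_ne_zero _ two_ne_zero) h2
    omega

theorem gamMk_eq_one_iff {r : ℕ} {x : Gam} : gamMk r x = 1 ↔ (x : ℤ_[2]ˣ) ∈ padicSubgroup r := by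
  rw [← map_one (gamMk r), gamMk_eq, mem_padicSubgroup, Subgroup.coe_one, Units.val_one, map_one]

end Gamma

/-! ### The tower of levels and its limit -/

section Tower

open CongruenceSubgroup

/-- The level `s + n`. -/
abbrev Level.shift (s : Level) (n : ℕ) : Level := ⟨s.1 + n, s.2.trans (Nat.le_add_right _ _)⟩

theorem two_dvd_level (N : ℕ) (s : Level) : 2 ∣ N * 2 ^ s.1 :=
  (dvd_pow_self 2 (by have := s.2; omega)).mul_left N

theorem transition_transition (N : ℕ) {r s t : Level} (h : s.1 ≤ r.1) (h' : t.1 ≤ s.1)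
    (x : Homology N r) : transition N h' (transition N h x) = transition N (h'.trans h) x :=
  tensorIncl_trans (P := Gamma1 (N * 2 ^ r.1)) (Q := Gamma1 (N * 2 ^ s.1))
    (S := Gamma1 (N * 2 ^ t.1)) (levelGroup_anti N h) (levelGroup_anti N h')
    (levelGroup_anti N (h'.trans h)) x

theorem transition_self (N : ℕ) (r : Level) (x : Homology N r) :
    transition N (le_refl r.1) x = x := by
  have h1 : levelMap N (le_refl r.1) = MonoidHom.id (LevelAb N r) := MonoidHom.ext fun y => by
    induction y using QuotientGroup.induction_on with
    | H z => rfl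
  exact LinearMap.congr_fun ((congrArg extend h1).trans extend_id) x

variable (N : ℕ) [Fact (Nat.Coprime 2 N)]

instance (r : ℕ) : (heckeSubgroup (toGL (Gamma1 (N * 2 ^ r))) (toGL (Gamma1 (N * 2 ^ r)))
    tMat).FiniteIndex :=
  inferInstanceAs (heckeSubgroup (levelGroup N r) (levelGroup N r) tMat).FiniteIndex

theorem iwasawaOf_smul (r : Level) (γ : Gam) (x : Homology N r) :
    iwasawaOf γ • x = extend (nebentypus N r (gamMk r γ)).toMonoidHom x := by
  change (homologyRep N r).asAlgebraHom (MonoidAlgebra.of ℤ_[2] (GamQuot r) (gamMk r γ)) x = _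
  rw [Representation.asAlgebraHom_of]
  rfl

theorem neZero_of_coprime (s : ℕ) : NeZero (N * 2 ^ s) := by
  refine ⟨mul_ne_zero ?_ (pow_ne_zero _ two_ne_zero)⟩
  rintro rfl
  exact absurd (Fact.out : Nat.Coprime 2 0) (by decide)

instance homology_finite (r : Level) : Module.Finite ℤ_[2] (Homology N r) := by
  have := neZero_of_coprime N r
  exact tensorAb_toGL_finite (Gamma1 (N * 2 ^ r.1))

theorem transition_opU {r s : Level} (h : s.1 ≤ r.1) (x : Homology N r) :
    transition N h (opU N r x) = opU N s (transition N h x) := by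
  refine tensorIncl_tensorU (conjStable_Gamma1 (two_dvd_level N r))
    (conjStable_Gamma1 (two_dvd_level N s)) ?_ (levelGroup_anti N h) x
  exact (Subgroup.map_le_map_iff_of_injective Matrix.SpecialLinearGroup.mapGL_injective).1
    (levelGroup_anti N h)

theorem transition_mem {r s : Level} (h : s.1 ≤ r.1) {x : Homology N r}
    (hx : x ∈ OrdHomology N r) : transition N h x ∈ OrdHomology N s :=
  map_mem_ordinaryPart (U := opU N r) (U' := opU N s) (transition N h) (transition_opU N h) hx

theorem exists_transition_eq_shift_one (s : Level) {y : Homology N s} (hy : y ∈ OrdHomology N s) :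
    ∃ x ∈ OrdHomology N (s.shift 1), transition N (Nat.le_add_right s.1 1) x = y := by
  have := neZero_of_coprime N s
  exact exists_ordinary_tensorIncl_eq (n := N * 2 ^ s.1) (m := N * 2 ^ (s.1 + 1))
    (two_dvd_level N s) (by rw [pow_succ, mul_assoc])
    (levelGroup_anti N (Nat.le_add_right s.1 1)) hy

theorem exists_smul_sub_eq_shift_one (s : Level) (γ : Gam) (hγ : (γ : ℤ_[2]ˣ) ∈ padicSubgroup s)
    (hγ' : (γ : ℤ_[2]ˣ) ∉ padicSubgroup (s.1 + 1)) {x : Homology N (s.shift 1)}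
    (hx : x ∈ OrdHomology N (s.shift 1))
    (hx0 : transition N (s := s) (Nat.le_add_right s.1 1) x = 0) :
    ∃ y ∈ OrdHomology N (s.shift 1), x = iwasawaOf γ • y - y := by
  have := neZero_of_coprime N s
  have hm : N * 2 ^ (s.1 + 1) = N * 2 ^ s.1 * 2 := by rw [pow_succ, mul_assoc]
  have hN : Nat.Coprime 2 N := Fact.out
  -- γ acts through conjugation by a matrix α in Φ_{s+1}. That γ is in Γ_s puts α in the
  -- intermediate group, and that γ is not in Γ_{s+1} keeps it out of Γ₁(N2^{s+1}).
  obtain ⟨α, hα, -⟩ := eta_surjective N (s.shift 1) (gamMk _ γ)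
  have hinj : ∀ (n : ℕ), Matrix.SpecialLinearGroup.mapGL ℚ α.1 ∈ levelGroup N n →
      α.1 ∈ Gamma1 (N * 2 ^ n) := fun n h =>
    (Subgroup.mem_map_iff_mem Matrix.SpecialLinearGroup.mapGL_injective).1 h
  have h1 := mem_Gamma1_iff.1 α.2.1
  have h0 := mem_Gamma0_iff.1 α.2.2
  have hN0 : (N : ℤ) ∣ α.1 1 0 :=
    (Int.natCast_dvd_natCast.2 (dvd_mul_right N (2 ^ 2))).trans h1.2.2
  have hA : α.1 ∈ midGamma (N * 2 ^ s.1) := by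
    refine ⟨hinj _ ((mem_levelGroup_iff N s α.1).2 ⟨⟨α.2.1, mem_Gamma0_iff.2 ?_⟩, ?_⟩),
      mem_Gamma0_iff.2 ?_⟩
    · exact (Int.natCast_dvd_natCast.2 (pow_dvd_pow 2 (Nat.le_add_right s.1 1))).trans h0
    · exact (congrArg (gamProj (Nat.le_add_right s.1 1)) hα).trans (gamMk_eq_one_iff.2 hγ)
    · rw [← hm, Nat.cast_mul]
      exact IsCoprime.mul_dvd (Nat.isCoprime_iff_coprime.2 (hN.symm.pow_right _)) hN0 h0
  have hA' : α.1 ∉ Gamma1 (N * 2 ^ (s.1 + 1)) := fun h => by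
    obtain ⟨_, h2⟩ := (mem_levelGroup_iff N (s.shift 1) α.1).1 ⟨α.1, h, rfl⟩
    exact hγ' (gamMk_eq_one_iff.1 (hα.symm.trans h2))
  obtain ⟨(y : Homology N (s.shift 1)), hy, hxy⟩ := exists_ordinary_eq_conj_sub
    (n := N * 2 ^ s.1) (m := N * 2 ^ (s.1 + 1))
    (two_dvd_level N s) hm (levelGroup_anti N (Nat.le_add_right s.1 1)) hA hA'
    (fun k hk => phi_conj_mem N (s.shift 1) α k hk)
    (nebentypus N (s.shift 1) (gamMk _ γ)).toMonoidHom
    (fun k => by rw [← hα]; exact nebentypus_eta_of N (s.shift 1) α k)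
    (fun y => (atkinU_nebentypus N (s.shift 1) (gamMk _ γ) y).symm) hx hx0
  exact ⟨y, hy, hxy.trans (congrArg (fun z : Homology N (s.shift 1) => z - y)
    (iwasawaOf_smul N (s.shift 1) γ y).symm)⟩

theorem exists_transition_eq (n : ℕ) : ∀ {r s : Level} (h : s.1 ≤ r.1), r.1 = s.1 + n →
    ∀ {y : Homology N s}, y ∈ OrdHomology N s → ∃ x ∈ OrdHomology N r, transition N h x = y := by
  induction n with
  | zero =>
    intro r s h hr y hy
    obtain rfl : r = s := Subtype.ext hr
    exact ⟨y, hy, transition_self N r y⟩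
  | succ n ih =>
    intro r s h hr y hy
    obtain ⟨z, hz, rfl⟩ := exists_transition_eq_shift_one N s hy
    obtain ⟨x, hx, rfl⟩ := ih (r := r) (s := s.shift 1) (by change s.1 + 1 ≤ r.1; omega)
      (by change r.1 = s.1 + 1 + n; omega) hz
    exact ⟨x, hx, (transition_transition N _ _ x).symm⟩

/-- Induction with γ varying. The image of x at level s + 1 is (γ - 1)y; lifting y to z at level r
leaves x - (γ - 1)z in the kernel down to level s + 1, where the induction hypothesis applies to γ².
-/
theorem exists_smul_sub_eq (n : ℕ) : ∀ {r s : Level} (h : s.1 ≤ r.1), r.1 = s.1 + n →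
    ∀ γ : Gam, (γ : ℤ_[2]ˣ) ∈ padicSubgroup s → (γ : ℤ_[2]ˣ) ∉ padicSubgroup (s.1 + 1) →
    ∀ {x : Homology N r}, x ∈ OrdHomology N r → transition N h x = 0 →
      ∃ y ∈ OrdHomology N r, x = iwasawaOf γ • y - y := by
  induction n with
  | zero =>
    intro r s h hr γ _ _ x _ hx0
    obtain rfl : r = s := Subtype.ext hr
    rw [transition_self] at hx0
    exact ⟨0, (OrdHomology N r).zero_mem, by rw [hx0, smul_zero, sub_zero]⟩
  | succ n ih =>
    intro r s h hr γ hγ hγ' x hx hx0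
    have hle : (s.shift 1).1 ≤ r.1 := by change s.1 + 1 ≤ r.1; omega
    have hr' : r.1 = (s.shift 1).1 + n := by change r.1 = s.1 + 1 + n; omega
    obtain ⟨y, hy, hxy⟩ := exists_smul_sub_eq_shift_one N s γ hγ hγ' (transition_mem N hle hx)
      (by rw [transition_transition]; exact hx0)
    obtain ⟨z, hz, rfl⟩ := exists_transition_eq N n hle hr' hy
    obtain ⟨h1, h2⟩ := sq_mem_padicSubgroup s.2 hγ
    rw [← Subgroup.coe_pow] at h1 h2
    obtain ⟨u, hu, hxu⟩ := ih hle hr' (γ ^ 2) h1 (fun h => hγ' (h2 h))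
      (x := x - (iwasawaOf γ • z - z))
      (Submodule.sub_mem _ hx (Submodule.sub_mem _ (Submodule.smul_mem _ _ hz) hz))
      (by rw [map_sub, map_sub, transition_smul, hxy, sub_self])
    -- x = (γ - 1)z + (γ² - 1)u and γ² - 1 = (γ - 1)(γ + 1).
    refine ⟨z + (iwasawaOf γ • u + u), Submodule.add_mem _ hz
      (Submodule.add_mem _ (Submodule.smul_mem _ _ hu) hu), ?_⟩
    rw [sub_eq_iff_eq_add] at hxu
    rw [hxu, map_pow, pow_two, mul_smul, smul_add, smul_add]
    abel

/-- A compatible sequence of ordinary elements of the levels `s + n` extends to an element of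
`Wᵒʳᵈ`. -/
theorem exists_ordLimit_of_seq (s : Level) (x : ∀ n, Homology N (s.shift n))
    (hx : ∀ n, x n ∈ OrdHomology N (s.shift n))
    (hc : ∀ n, transition N (r := s.shift (n + 1)) (s := s.shift n) (Nat.le_succ _) (x (n + 1)) =
      x n) :
    ∃ w ∈ OrdLimit N, ∀ n, w (s.shift n) = x n := by
  have hc' : ∀ k n m : ℕ, m = n + k → ∀ h : (s.shift n).1 ≤ (s.shift m).1,
      transition N h (x m) = x n := by
    intro k
    induction k with
    | zero =>
      rintro n m rfl h
      exact transition_self N _ _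
    | succ k ih =>
      rintro n m rfl h
      rw [← ih n (n + k) rfl (Nat.add_le_add_left (Nat.le_add_right n k) s.1), ← hc (n + k),
        transition_transition]
      rfl
  have hle : ∀ r : Level, r.1 ≤ (s.shift r.1).1 := fun r => Nat.le_add_left _ _
  -- The component at level r is the image of the term at level s + r, which is at least r; by
  -- compatibility any later term gives the same value.
  refine ⟨fun r => transition N (hle r) (x r.1), Submodule.mem_inf.2 ⟨fun r r' h => ?_, ?_⟩,
    fun n => hc' s.1 n (s.shift n).1 (Nat.add_comm _ _) (hle _)⟩
  · have h1 := hc' (r.1 - r'.1) r'.1 r.1 (by omega) (Nat.add_le_add_left h s.1)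
    rw [transition_transition]
    change _ = transition N _ (x r'.1)
    rw [← h1, transition_transition]
  · exact fun r _ => transition_mem N _ (hx _)

/-- The transition maps are surjective on ordinary parts, so y is lifted recursively along the
cofinal levels s + n. -/
theorem exists_ordLimit_apply_eq (s : Level) {y : Homology N s} (hy : y ∈ OrdHomology N s) :
    ∃ w ∈ OrdLimit N, w s = y := by
  have hstep : ∀ n, ∀ z : OrdHomology N (s.shift n), ∃ z' : OrdHomology N (s.shift (n + 1)),
      transition N (r := s.shift (n + 1)) (s := s.shift n) (Nat.le_succ _) z' = z := fun n z => by
    obtain ⟨x, hx, h⟩ := exists_transition_eq N 1 (r := s.shift (n + 1)) (s := s.shift n)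
      (Nat.le_succ _) rfl z.2
    exact ⟨⟨x, hx⟩, h⟩
  choose f hf using hstep
  let x : ∀ n, OrdHomology N (s.shift n) := fun n => Nat.rec ⟨y, hy⟩ f n
  obtain ⟨w, hw, hwx⟩ := exists_ordLimit_of_seq N s (fun n => (x n).1) (fun n => (x n).2)
    fun n => hf n (x n)
  exact ⟨w, hw, hwx 0⟩

/-- The equation (γ - 1)x = w is solvable at each level s + n, but its solutions are only determined
up to elements fixed by γ. Compactness provides a compatible choice. -/
theorem exists_ordLimit_eq_smul_sub (s : Level) (γ : Gam) (hγ : (γ : ℤ_[2]ˣ) ∈ padicSubgroup s)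
    (hγ' : (γ : ℤ_[2]ˣ) ∉ padicSubgroup (s.1 + 1)) {w : (r : Level) → Homology N r}
    (hw : w ∈ OrdLimit N) (hw0 : w s = 0) :
    ∃ x ∈ OrdLimit N, w = iwasawaOf γ • x - x := by
  obtain ⟨hw1, hw2⟩ := Submodule.mem_inf.1 hw
  let a : ∀ n, ordinaryPart (opU N (s.shift (n + 1))) →ₗ[ℤ_[2]] ordinaryPart (opU N (s.shift n)) :=
    fun n => (transition N (r := s.shift (n + 1)) (s := s.shift n) (Nat.le_succ _)).restrict
      fun x hx => transition_mem N _ hx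
  let φ : ∀ n, ordinaryPart (opU N (s.shift n)) →ₗ[ℤ_[2]] Homology N (s.shift n) := fun n =>
    (homologyRep N (s.shift n) (gamMk _ γ) - LinearMap.id) ∘ₗ (ordinaryPart _).subtype
  have hφ : ∀ n x, φ n x = iwasawaOf γ • x.1 - x.1 := fun n x => by
    rw [iwasawaOf_smul]; rfl
  obtain ⟨x, hx1, hx2⟩ := exists_compatible_preimage a
    (fun n => transition N (r := s.shift (n + 1)) (s := s.shift n) (Nat.le_succ _)) φ
    (fun n x => by rw [hφ, hφ, map_sub, transition_smul]; rfl) (fun n => w (s.shift n))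
    (fun n => hw1 _ _ _) fun n => by
      obtain ⟨y, hy, hwy⟩ := exists_smul_sub_eq N n (r := s.shift n) (s := s)
        (Nat.le_add_right _ _) rfl γ hγ hγ' (hw2 _ trivial) ((hw1 _ _ _).trans hw0)
      exact ⟨⟨y, hy⟩, by rw [hφ, hwy]⟩
  obtain ⟨v, hv, hvx⟩ := exists_ordLimit_of_seq N s (fun n => (x n).1) (fun n => (x n).2)
    fun n => congrArg Subtype.val (hx1 n)
  refine ⟨v, hv, funext fun r => ?_⟩
  -- The equation holds at the levels s + n; at an arbitrary r it is the image of the one at s + r.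
  have h1 := hw1 (s.shift r.1) r (Nat.le_add_left _ _)
  have h2 := (Submodule.mem_inf.1 hv).1 (s.shift r.1) r (Nat.le_add_left _ _)
  rw [← h1, ← hx2, hφ, ← hvx, map_sub, transition_smul, h2]
  rfl

/-- The projection from `Wᵒʳᵈ` to the ordinary part at level `r`. -/
def ordProj (r : Level) : OrdLimit N →ₗ[Iwasawa] OrdHomology N r :=
  ((LinearMap.proj r).comp (OrdLimit N).subtype).codRestrict (OrdHomology N r)
    fun w => (Submodule.mem_inf.1 w.2).2 r trivial

theorem ordProj_surjective (r : Level) : Function.Surjective (ordProj N r) := fun y => by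
  obtain ⟨w, hw, h⟩ := exists_ordLimit_apply_eq N r y.2
  exact ⟨⟨w, hw⟩, Subtype.ext h⟩

/-- Any γ in Γ_r ∖ Γ_{r+1} works. A single difference suffices, so both the 𝔞_r-quotient and the
coinvariants are covered at once. -/
theorem exists_mem_gamSub_eq_smul_sub (r : Level) {w : OrdLimit N} (hw : ordProj N r w = 0) :
    ∃ γ ∈ gamSub r.1, ∃ x, w = iwasawaOf γ • x - x := by
  obtain ⟨γ, hγ, hγ'⟩ := exists_mem_padicSubgroup_not_mem_succ r.2
  obtain ⟨x, hx, h⟩ := exists_ordLimit_eq_smul_sub N r γ hγ hγ' w.2 (congrArg Subtype.val hw)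
  exact ⟨γ, hγ, ⟨x, hx⟩, Subtype.ext h⟩

theorem iwasawaOf_sub_one_mem_augIdeal (r : Level) {γ : Gam} (hγ : γ ∈ gamSub r.1) :
    iwasawaOf γ - 1 ∈ augIdeal r := by
  have h1 : iwasawaProj r (iwasawaOf γ) = MonoidAlgebra.of ℤ_[2] (GamQuot r) (gamMk r γ) := rfl
  rw [augIdeal, RingHom.mem_ker, map_sub, map_one, h1, gamMk_eq_one_iff.2 hγ, map_one, sub_self]

/-- γ - 1 is in 𝔞_r for γ in Γ_r, which gives one inclusion; the other holds because Λ acts at level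
r through ℤ₂[Γ/Γ_r]. -/
theorem ker_ordProj (r : Level) : LinearMap.ker (ordProj N r) = augIdeal r • ⊤ := by
  refine le_antisymm (fun w hw => ?_) (Submodule.smul_le.2 fun a ha w _ => ?_)
  · obtain ⟨γ, hγ, x, rfl⟩ := exists_mem_gamSub_eq_smul_sub N r hw
    have h1 := Submodule.smul_mem_smul (N := (⊤ : Submodule Iwasawa (OrdLimit N)))
      (iwasawaOf_sub_one_mem_augIdeal r hγ) (Submodule.mem_top (x := x))
    rwa [sub_smul, one_smul] at h1
  · rw [LinearMap.mem_ker, map_smul]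
    refine Subtype.ext ?_
    change (homologyRep N r).asAlgebraHom (iwasawaProj r a) _ = 0
    rw [show iwasawaProj r a = 0 from ha, map_zero, LinearMap.zero_apply]

theorem ordProj_smul_of_mem (r : Level) {γ : Gam} (hγ : γ ∈ gamSub r.1) (w : OrdLimit N) :
    ordProj N r (iwasawaOf γ • w) = ordProj N r w := by
  have h1 := Submodule.smul_mem_smul (N := (⊤ : Submodule Iwasawa (OrdLimit N)))
    (iwasawaOf_sub_one_mem_augIdeal r hγ) (Submodule.mem_top (x := w))
  rwa [← ker_ordProj, sub_smul, one_smul, LinearMap.mem_ker, map_sub, sub_eq_zero] at h1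

end Tower

end TwoAdicControl

end

theorem mainTheorem3 (N : ℕ) [Fact (Nat.Coprime 2 N)] (r : TwoAdicControl.Level) :
    (∃ e : (TwoAdicControl.OrdLimit N ⧸
          (TwoAdicControl.augIdeal r • ⊤ : Submodule TwoAdicControl.Iwasawa
            (TwoAdicControl.OrdLimit N)))
        ≃ₗ[TwoAdicControl.Iwasawa] TwoAdicControl.OrdHomology N r,
      ∀ w : TwoAdicControl.OrdLimit N, e (Submodule.Quotient.mk w) = w.1 r) ∧
    (∃ e : (TwoAdicControl.gamRep r (TwoAdicControl.OrdLimit N)).Coinvariants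
        ≃ₗ[ℤ_[2]] TwoAdicControl.OrdHomology N r,
      ∀ w : TwoAdicControl.OrdLimit N,
        e (Representation.Coinvariants.mk _ w) = w.1 r) := by
  refine ⟨⟨(Submodule.quotEquivOfEq _ _ (TwoAdicControl.ker_ordProj N r).symm).trans
    (LinearMap.quotKerEquivOfSurjective _ (TwoAdicControl.ordProj_surjective N r)),
    fun w => rfl⟩, ?_⟩
  let f := Representation.Coinvariants.lift
    (TwoAdicControl.gamRep r (TwoAdicControl.OrdLimit N))
    ((TwoAdicControl.ordProj N r).restrictScalars ℤ_[2])
    fun γ => LinearMap.ext fun w => TwoAdicControl.ordProj_smul_of_mem N r γ.2 w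
  refine ⟨LinearEquiv.ofBijective f ⟨?_, fun y => ?_⟩, fun w => rfl⟩
  · rw [← LinearMap.ker_eq_bot, LinearMap.ker_eq_bot']
    intro x hx
    induction x using Representation.Coinvariants.induction_on with
    | h w =>
      -- A representative with zero projection is γv - v with γ in Γ_r, so it is trivial in the
      -- coinvariants.
      obtain ⟨γ, hγ, v, rfl⟩ := TwoAdicControl.exists_mem_gamSub_eq_smul_sub N r hx
      exact (Representation.Coinvariants.mk_eq_zero _).2
        (Representation.Coinvariants.sub_mem_ker (⟨γ, hγ⟩ : TwoAdicControl.gamSub r) v)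
  · obtain ⟨w, hw⟩ := TwoAdicControl.ordProj_surjective N r y
    exact ⟨Representation.Coinvariants.mk _ w, hw⟩
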